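/- Let $F$ be an algebraically closed field of characteristic $0$ and let $\mathcal C$ be a semisimple $F$-linear (abelian) rigid braided ribbon category, with braiding $c$, twist $\Theta$ and dimension function $d$, with finite-dimensional $\mathrm{Hom}$-spaces and $\mathrm{End}\,\mathbf 1=F\,\mathrm{id}_{\mathbf 1}$. Let $\mathcal S\subset\mathcal C$ be a replete full tensor subcategory, closed under duals, finite direct sums and direct summands, with finitely many isomorphism classes of simple objects. (0) The following are equivalent: (i) $\mathcal S$ is symmetric ($c_{Y,X}\circ c_{X,Y}=\mathrm{id}$ for all $X,Y\in\mathcal S$), even ($\Theta(X)=\mathrm{id}_X$ for all $X\in\mathcal S$), and $d(X)=1$ for all simple $X\in\mathcal S$; (ii) there is a finite abelian group $G$ with $\mathcal S\simeq\mathrm{Rep}_F G$, as $F$-linear braided ribbon categories, where $\mathrm{Rep}_FG$ is the category of finite-dimensional representations with the usual symmetry and trivial twist. Now let $G$ be a finite abelian group with an equivalence $\mathrm{Rep}_F G\simeq\mathcal S$ as in (ii), and let $(\Gamma,m,\eta)$ be the regular monoid in $\mathcal S$, i.e. the image of the algebra of functions $G\to F$ (pointwise product, left regular action of $G$). Then: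 (1) Right translations of functions identify $G$ with $\mathrm{Aut}(\Gamma,m,\eta)=\{g\in\mathrm{End}\,\Gamma\mid g\circ m=m\circ(g\otimes g),\ g\circ\eta=\eta\}$. (2) For every simple $X\in\mathcal C$, $$\partial_0X=d(X)^{-1}\,(\mathrm{id}_\Gamma\otimes \mathrm{Tr}_X)(c_{X,\Gamma}\circ c_{\Gamma,X})\in\mathrm{End}\,\Gamma$$ is an element of $G=\mathrm{Aut}(\Gamma,m,\eta)$. (3) Call an object $X$ of $\mathcal C$ homogeneous of degree $\partial X=g\in G$ if $X\neq0$ and $\partial_0Y=g$ for all simple direct summands $Y$ of $X$, and let $\mathcal C_G\subset\mathcal C$ be the full subcategory of homogeneous objects. Then $\mathcal C$ is a $G$-graded tensor category, that is, a crossed $G$-category with trivial $G$-action: $\mathcal C_G$ contains $\mathbf 1$ and is closed under $\otimes$, $\partial$ is well defined and constant on isomorphism classes, $\partial(X\otimes Y)=\partial X\,\partial Y$ for $X,Y\in\mathcal C_G$, with the trivial action $\gamma_g=\mathrm{id}_{\mathcal C}$ one has $\partial(\gamma_g(X))=g\,\partial X\,g^{-1}$, and every object of $\mathcal C$ is a finite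 direct sum of homogeneous objects. Moreover $\mathrm{Hom}(X,Y)=\{0\}$ if $X,Y\in\mathcal C_G$ and $\partial X\neq\partial Y$. -/

import Mathlib

open CategoryTheory CategoryTheory.MonoidalCategory CategoryTheory.Limits
open scoped CategoryTheory.MonObj

universe u v w

noncomputable section

namespace GradedBTC

attribute [local instance] Abelian.hasFiniteBiproducts

section Ribbon

variable (C : Type w) [Category.{v} C] [MonoidalCategory C] [BraidedCategory C]
  [RightRigidCategory C]

/-- A ribbon structure on a rigid braided category: a natural automorphism `θ` of the identity
(the twist) with `θ_{X ⊗ Y} = c_{Y,X} ∘ c_{X,Y} ∘ (θ_X ⊗ θ_Y)` and `(θ_X)^* = θ_{X^*}`. -/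
class RibbonCategory where
  twist : ∀ X : C, X ≅ X
  twist_naturality : ∀ {X Y : C} (f : X ⟶ Y), f ≫ (twist Y).hom = (twist X).hom ≫ f
  twist_tensor : ∀ X Y : C, (twist (X ⊗ Y)).hom =
    ((twist X).hom ⊗ₘ (twist Y).hom) ≫ (β_ X Y).hom ≫ (β_ Y X).hom
  twist_dual : ∀ X : C, rightAdjointMate (twist X).hom = (twist (Xᘁ)).hom

variable {C} [RibbonCategory C]

/-- The twist `Θ(X)` of an object. -/
def twist (X : C) : X ≅ X := RibbonCategory.twist X

/-- The evaluation `X ⊗ X^* ⟶ 𝟙` on the other side, determined by the ribbon structure. -/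
def evalRibbon (X : C) : X ⊗ Xᘁ ⟶ 𝟙_ C :=
  (twist X).hom ▷ Xᘁ ≫ (β_ X Xᘁ).hom ≫ ε_ X Xᘁ

/-- The dimension of `X` as an endomorphism of the unit. -/
def dimEnd (X : C) : 𝟙_ C ⟶ 𝟙_ C := η_ X Xᘁ ≫ evalRibbon X

/-- The partial trace `(id_A ⊗ Tr_X)(f)`. -/
def partialTrace (A X : C) (f : A ⊗ X ⟶ A ⊗ X) : A ⟶ A :=
  (ρ_ A).inv ≫ A ◁ η_ X Xᘁ ≫ (α_ A X Xᘁ).inv ≫ f ▷ Xᘁ ≫ (α_ A X Xᘁ).hom ≫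
    A ◁ evalRibbon X ≫ (ρ_ A).hom

/-- The double braiding `c_{X,A} ∘ c_{A,X}` on `A ⊗ X`. -/
def doubleBraiding (A X : C) : A ⊗ X ⟶ A ⊗ X := (β_ A X).hom ≫ (β_ X A).hom

end Ribbon

section BTC

variable (F : Type u) [Field F]
variable (C : Type w) [Category.{v} C] [Abelian C] [Linear F C] [MonoidalCategory C]

/-- Semisimplicity, finite-dimensional `Hom`-spaces, and `End 𝟙 = F`, for an `F`-linear abelian
monoidal category. -/
class IsSemisimpleTensor : Prop where
  semisimple : ∀ X : C, ∃ (n : ℕ) (Y : Fin n → C),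
    (∀ i, Simple (Y i)) ∧ Nonempty (X ≅ ⨁ Y)
  finite_hom : ∀ X Y : C, FiniteDimensional F (X ⟶ Y)
  end_unit : Function.Bijective (fun a : F => a • 𝟙 (𝟙_ C))

variable {C} [IsSemisimpleTensor F C]

/-- The scalar `a` with `f = a • id`, for an endomorphism `f` of the unit object. -/
def unitScalar (f : 𝟙_ C ⟶ 𝟙_ C) : F :=
  (IsSemisimpleTensor.end_unit (F := F) (C := C)).2 f |>.choose

variable [BraidedCategory C] [RightRigidCategory C] [RibbonCategory C]

/-- The dimension `d(X) ∈ F`. -/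
def dim (X : C) : F := unitScalar F (dimEnd X)

end BTC

section Subcategory

variable {C : Type w} [Category.{v} C] [Abelian C] [MonoidalCategory C]
  [BraidedCategory C] [RightRigidCategory C]

/-- `S` is (the class of objects of) a replete full semisimple rigid tensor subcategory with
finitely many isomorphism classes of simple objects. -/
structure IsFiniteFullTensorSubcategory (S : ObjectProperty C) : Prop where
  iso : ∀ {X Y : C}, (X ≅ Y) → S X → S Y
  unit : S (𝟙_ C)
  tensor : ∀ {X Y : C}, S X → S Y → S (X ⊗ Y)
  dual : ∀ {X : C}, S X → S (Xᘁ)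
  sum : ∀ {n : ℕ} (X : Fin n → C), (∀ i, S (X i)) → S (⨁ X)
  summand : ∀ {X Y : C}, Retract Y X → S X → S Y
  finite : ∃ (n : ℕ) (Z : Fin n → C), ∀ X : C, S X → Simple X → ∃ i, Nonempty (X ≅ Z i)

/-- The braiding restricts to a symmetry on `S`. -/
def IsSymmetric (S : ObjectProperty C) : Prop :=
  ∀ X Y : C, S X → S Y → (β_ X Y).hom ≫ (β_ Y X).hom = 𝟙 (X ⊗ Y)

/-- All objects of `S` have trivial twist. -/
def IsEven [RibbonCategory C] (S : ObjectProperty C) : Prop :=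
  ∀ X : C, S X → (twist X).hom = 𝟙 X

end Subcategory

section RegularMonoid

open TannakaDuality.FiniteGroup

variable (F G : Type u) [Field F] [Group G] [Finite G]

/-- The left regular representation of `G` on the functions `G → F`, `(s • f)(t) = f(s⁻¹ t)`. -/
def regRep : FDRep F G := FDRep.of (leftRegular (k := F) (G := G))

/-- Pointwise multiplication of functions. -/
def regMul : regRep F G ⊗ regRep F G ⟶ regRep F G where
  hom := InducedCategory.homMk (ModuleCat.ofHom (LinearMap.mul' F (G → F)))
  comm := by
    intro
    ext u
    refine TensorProduct.induction_on u rfl (fun _ _ ↦ rfl) (fun _ _ hx hy ↦ ?_)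
    simp only [map_add, hx, hy]

/-- The constant functions. -/
def regOne : 𝟙_ (FDRep F G) ⟶ regRep F G where
  hom := InducedCategory.homMk (ModuleCat.ofHom (Algebra.linearMap F (G → F)))
  comm := by
    intro
    ext
    rfl

/-- The regular monoid of `G`: the algebra of functions on `G` as a monoid in `Rep G`. -/
instance regMonObj : MonObj (regRep F G) where
  one := regOne F G
  mul := regMul F G
  one_mul := by
    ext u
    refine TensorProduct.induction_on u ?_ (fun a f ↦ ?_) (fun _ _ hx hy ↦ ?_)
    · simp only [map_zero]
    · exact (Algebra.smul_def (A := G → F) a f).symm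
    · simp only [map_add, hx, hy]
  mul_one := by
    ext u
    refine TensorProduct.induction_on u ?_ (fun f a ↦ ?_) (fun _ _ hx hy ↦ ?_)
    · simp only [map_zero]
    · exact (mul_comm (G := G → F) f _).trans (Algebra.smul_def (A := G → F) a f).symm
    · simp only [map_add, hx, hy]
  mul_assoc := by
    ext u
    refine TensorProduct.induction_on u ?_ (fun fg h ↦ ?_) (fun _ _ hx hy ↦ ?_)
    · simp only [map_zero]
    · refine TensorProduct.induction_on fg ?_ (fun f g ↦ ?_) (fun _ _ hx hy ↦ ?_)
      · simp only [TensorProduct.zero_tmul, map_zero]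
      · exact mul_assoc (G := G → F) f g h
      · simp only [TensorProduct.add_tmul, map_add, hx, hy]
    · simp only [map_add, hx, hy]

/-- Right translations `f ↦ f(· s)`, as endomorphisms of the left regular representation. -/
def regTranslation : G →* End (regRep F G) where
  toFun s :=
    { hom := InducedCategory.homMk (ModuleCat.ofHom (rightRegular (k := F) s))
      comm := by
        intro t
        ext f
        funext x
        exact congrArg f (mul_assoc _ _ _).symm }
  map_one' := by
    apply Action.hom_ext
    ext f
    funext x
    exact congrArg f (mul_one x)
  map_mul' s t := by
    apply Action.hom_ext
    ext f
    funext x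
    exact congrArg f (mul_assoc x s t).symm

end RegularMonoid
section Crossed

variable (G : Type u) [Group G] (C : Type w) [Category.{v} C] [MonoidalCategory C]

variable {C} in
/-- A strict tensor functor `C ⥤ C`: it preserves the unit object, tensor products of objects and
of morphisms, and the constraints, on the nose. -/
structure IsStrictTensorFunctor (T : C ⥤ C) : Prop where
  unit : T.obj (𝟙_ C) = 𝟙_ C
  tensor_obj : ∀ X Y : C, T.obj (X ⊗ Y) = T.obj X ⊗ T.obj Y
  tensor_map : ∀ {X X' Y Y' : C} (f : X ⟶ X') (g : Y ⟶ Y'),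
    HEq (T.map (f ⊗ₘ g)) (T.map f ⊗ₘ T.map g)
  associator : ∀ X Y Z : C,
    HEq (T.map (α_ X Y Z).hom) (α_ (T.obj X) (T.obj Y) (T.obj Z)).hom
  leftUnitor : ∀ X : C, HEq (T.map (λ_ X).hom) (λ_ (T.obj X)).hom
  rightUnitor : ∀ X : C, HEq (T.map (ρ_ X).hom) (ρ_ (T.obj X)).hom

/-- The structure of a crossed `G`-category on an additive tensor category `C`: a full tensor
subcategory of homogeneous objects, a multiplicative degree map `∂` on them that is constant on
isomorphism classes, and an action `γ` of `G` by strict tensor automorphisms of `C` with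
`∂ (γ_g X) = g (∂ X) g⁻¹`; every object is a finite direct sum of homogeneous ones. -/
structure CrossedCategory [Abelian C] where
  homogeneous : ObjectProperty C
  homogeneous_unit : homogeneous (𝟙_ C)
  homogeneous_tensor : ∀ {X Y : C}, homogeneous X → homogeneous Y → homogeneous (X ⊗ Y)
  degree : ∀ X : C, homogeneous X → G
  degree_iso : ∀ {X Y : C} (hX : homogeneous X) (hY : homogeneous Y),
    (X ≅ Y) → degree X hX = degree Y hY
  degree_tensor : ∀ {X Y : C} (hX : homogeneous X) (hY : homogeneous Y),
    degree (X ⊗ Y) (homogeneous_tensor hX hY) = degree X hX * degree Y hY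
  action : G → (C ⥤ C)
  action_strict : ∀ g, IsStrictTensorFunctor (action g)
  action_one : action 1 = 𝟭 C
  action_mul : ∀ g h, action (g * h) = action h ⋙ action g
  homogeneous_action : ∀ (g : G) {X : C}, homogeneous X → homogeneous ((action g).obj X)
  degree_action : ∀ (g : G) {X : C} (hX : homogeneous X),
    degree ((action g).obj X) (homogeneous_action g hX) = g * degree X hX * g⁻¹
  decomposition : ∀ X : C, ∃ (n : ℕ) (Y : Fin n → C),
    (∀ i, homogeneous (Y i)) ∧ Nonempty (X ≅ ⨁ Y)

end Crossed

section RepEquivalence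

variable (F G : Type u) [Field F] [Group G]
variable {C : Type w} [Category.{v} C] [Abelian C] [Linear F C] [MonoidalCategory C]
  [BraidedCategory C] [RightRigidCategory C] [RibbonCategory C]

/-- An equivalence `Rep G ≃ S` of `F`-linear braided ribbon categories, `S` being a replete full
subcategory of `C` and `Rep G` carrying the usual symmetry and the trivial twist. It is given as a
fully faithful linear braided tensor functor `Rep G ⥤ C` with essential image `S`. -/
structure RepEquivalence (S : ObjectProperty C) where
  functor : FDRep F G ⥤ C
  braided : functor.Braided
  full : functor.Full
  faithful : functor.Faithful
  additive : functor.Additive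
  linear : functor.Linear F
  essImage_eq : functor.essImage = S
  twist_eq : ∀ V : FDRep F G, (twist (functor.obj V)).hom = 𝟙 (functor.obj V)

namespace RepEquivalence

variable {F G} {S : ObjectProperty C} [Finite G] (E : RepEquivalence F G S)

/-- The object `Γ` of `S` underlying the regular monoid. -/
def Γ : C := E.functor.obj (regRep F G)

/-- The regular monoid `(Γ, m, η)` in `S`. -/
instance monObj : MonObj E.Γ :=
  letI := E.braided
  E.functor.monObjObj (regRep F G)

/-- The elements of `G` as endomorphisms of `Γ`. -/
def toEnd : G →* End E.Γ := (E.functor.mapEnd (regRep F G)).comp (regTranslation F G)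

variable [IsSemisimpleTensor F C]

/-- The endomorphism `d(X)⁻¹ (id_Γ ⊗ Tr_X)(c_{X,Γ} ∘ c_{Γ,X})` of `Γ`. -/
def normalizedTrace (X : C) : End E.Γ :=
  (dim F X)⁻¹ • partialTrace E.Γ X (doubleBraiding E.Γ X)

/-- `X` is homogeneous of degree `g`: it is non-zero and `∂₀ Y = g` for all its simple
summands `Y`. -/
def IsHomogeneousOfDegree (X : C) (g : G) : Prop :=
  ¬ IsZero X ∧ ∀ Y : C, Simple Y → Nonempty (Retract Y X) → E.normalizedTrace Y = E.toEnd g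

end RepEquivalence

end RepEquivalence

end GradedBTC

end

set_option linter.unusedSectionVars false

noncomputable section

namespace GradedBTC

attribute [local instance] Abelian.hasFiniteBiproducts

/-! ### Simple objects, semisimplicity and duality -/

section Abelian

variable {C : Type w} [Category.{v} C] [Abelian C]

/-! Everything rests on the simple objects of S being invertible. For simple X in S, symmetry and
trivial twists make d multiplicative, so X ⊗ X* has dimension 1. It is a sum of n simple objects of
dimension 1, and characteristic zero forces n = 1 (`isIso_coevaluation`). The self-braiding of X is
then a scalar, and its partial trace, which is the twist, shows that this scalar is 1
(`braiding_self_eq_id`).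

(i) ⇒ (ii). The classes of simple objects form a finite abelian group A with representatives X_a.
Isomorphisms X_a ⊗ X_b ≅ X_ab compatible with associators and braidings are needed. The obstruction
is an abelian 3-cocycle on A with trivial quadratic form, and it is removed without cohomology.
There is a non-zero T on which all X_a act by commuting isomorphisms X_a ⊗ T ≅ T
(`exists_commuting_actions`). An isomorphism X_a ⊗ X_b ≅ X_ab is unique up to a scalar, and its
failure to match the actions on T lies in a commutative finite-dimensional algebra of endomorphisms
of T. A character of that algebra fixes the scalar, and coherence follows from coherence of the
actions (`exists_coherentFamily_of_actions`). With G the dual group of A, representations split into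
weight spaces indexed by A, and replacing each line of weight a by X_a gives the equivalence
(`realFunctor`, `realBraided`).

(ii) ⇒ (i). Symmetry and trivial twists are transported. A representation of an abelian group with
only scalar endomorphisms has trivial self-swap, and the partial trace of the self-braiding then
yields d = 1.

(1) An equivariant algebra endomorphism of the functions on G is determined by its composite with
evaluation at 1, which is evaluation at some point s (`exists_regTranslation_eq`).

(2), (3) If Y is invertible and X simple, then Y ⊗ X is simple, so their double braiding is a
scalar. Summing over the simple constituents Y of Γ, the double braiding of Γ with X is g ⊗ id_X.
Naturality and the hexagon make g a monoid endomorphism, and its partial trace is d(X) g with d(X) ≠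
0. For any non-zero X, being homogeneous of degree g means exactly that the double braiding with Γ
is g ⊗ id_X (`isHomogeneousOfDegree_iff`), and multiplicativity of the degree is again the hexagon.
-/

lemma not_isZero_of_simple (X : C) [Simple X] : ¬ IsZero X := fun h =>
  id_nonzero X (h.eq_of_src _ _)

lemma hom_eq_zero_of_not_iso {X Y : C} [Simple X] [Simple Y] (h : ¬ Nonempty (X ≅ Y))
    (f : X ⟶ Y) : f = 0 := by
  by_contra hf
  have := isIso_of_hom_simple hf
  exact h ⟨asIso f⟩

lemma id_eq_sum_of_iso_biproduct {n : ℕ} {X : C} {Y : Fin n → C} (e : X ≅ ⨁ Y) :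
    𝟙 X = ∑ i, (e.hom ≫ biproduct.π Y i) ≫ biproduct.ι Y i ≫ e.inv := by
  simp only [Category.assoc, ← Preadditive.comp_sum]
  simp only [← Category.assoc (biproduct.π Y _), ← Preadditive.sum_comp, biproduct.total]
  simp

end Abelian

section Linear

variable {F : Type u} [Field F] {C : Type w} [Category.{v} C] [Abelian C] [Linear F C]

/-- The idempotent of the retract is a scalar `a`, and `a • 𝟙 Y = 𝟙 Y` with `Y` non-zero forces `a =
1`. Simplicity is deduced from scalar endomorphisms in this way. -/
lemma nonempty_iso_of_retract_of_end {X Y : C} (hX : ∀ f : X ⟶ X, ∃ a : F, f = a • 𝟙 X)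
    (hY : 𝟙 Y ≠ 0) (r : Retract Y X) : Nonempty (Y ≅ X) := by
  obtain ⟨a, ha⟩ := hX (r.r ≫ r.i)
  have h1 : a • 𝟙 Y = 𝟙 Y := by
    have : r.i ≫ (r.r ≫ r.i) ≫ r.r = 𝟙 Y := by simp
    rw [ha] at this
    simpa using this
  have : (a - 1) • 𝟙 Y = 0 := by rw [sub_smul, h1, one_smul, sub_self]
  rcases smul_eq_zero.1 this with h | h
  · refine ⟨⟨r.i, r.r, r.retract, ?_⟩⟩
    rw [ha, sub_eq_zero.1 h, one_smul]
  · exact absurd h hY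

lemma smul_id_injective {X : C} (hX : ¬ IsZero X) {a b : F} (h : a • 𝟙 X = b • 𝟙 X) : a = b := by
  have : (a - b) • 𝟙 X = 0 := by rw [sub_smul, h, sub_self]
  rcases smul_eq_zero.1 this with h | h
  · exact sub_eq_zero.1 h
  · exact absurd ((IsZero.iff_id_eq_zero X).2 h) hX

end Linear

section Pairing

variable {C : Type w} [Category.{v} C] [Abelian C] [MonoidalCategory C] [MonoidalPreadditive C]

lemma evaluation_ne_zero {X X' : C} [ExactPairing X X'] (hX : ¬ IsZero X) : ε_ X X' ≠ 0 := by
  intro h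
  apply hX
  rw [IsZero.iff_id_eq_zero]
  have := ExactPairing.evaluation_coevaluation X X'
  rw [h] at this
  simp only [MonoidalPreadditive.whiskerLeft_zero, comp_zero] at this
  have h2 : (λ_ X).inv ≫ ((λ_ X).hom ≫ (ρ_ X).inv) ≫ (ρ_ X).hom = 0 := by rw [← this]; simp
  simpa using h2

lemma coevaluation_ne_zero {X X' : C} [ExactPairing X X'] (hX : ¬ IsZero X) : η_ X X' ≠ 0 := by
  intro h
  apply hX
  rw [IsZero.iff_id_eq_zero]
  have := ExactPairing.evaluation_coevaluation X X'
  rw [h] at this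
  simp only [MonoidalPreadditive.zero_whiskerRight, zero_comp] at this
  have h2 : (λ_ X).inv ≫ ((λ_ X).hom ≫ (ρ_ X).inv) ≫ (ρ_ X).hom = 0 := by rw [← this]; simp
  simpa using h2

end Pairing

section Semisimple

variable (F : Type u) [Field F]
variable {C : Type w} [Category.{v} C] [Abelian C] [Linear F C] [MonoidalCategory C]
  [IsSemisimpleTensor F C]

include F

lemma finiteDimensional_hom (X Y : C) : FiniteDimensional F (X ⟶ Y) :=
  IsSemisimpleTensor.finite_hom X Y

lemma exists_comp_eq_id_of_simple_source {Y X : C} [Simple Y] {f : Y ⟶ X} (hf : f ≠ 0) :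
    ∃ r : X ⟶ Y, f ≫ r = 𝟙 Y := by
  obtain ⟨n, Z, hZ, ⟨e⟩⟩ := IsSemisimpleTensor.semisimple F X
  have : ∃ i, f ≫ e.hom ≫ biproduct.π Z i ≠ 0 := by
    by_contra! h
    apply hf
    rw [← cancel_mono e.hom]
    ext i
    simpa using h i
  obtain ⟨i, hi⟩ := this
  have := hZ i
  have := isIso_of_hom_simple hi
  exact ⟨(e.hom ≫ biproduct.π Z i) ≫ inv (f ≫ e.hom ≫ biproduct.π Z i), by
    rw [← Category.assoc, IsIso.hom_inv_id]⟩

lemma exists_comp_eq_id_of_simple_target {Y X : C} [Simple Y] {f : X ⟶ Y} (hf : f ≠ 0) :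
    ∃ s : Y ⟶ X, s ≫ f = 𝟙 Y := by
  obtain ⟨n, Z, hZ, ⟨e⟩⟩ := IsSemisimpleTensor.semisimple F X
  have : ∃ i, (biproduct.ι Z i ≫ e.inv) ≫ f ≠ 0 := by
    by_contra! h
    apply hf
    rw [← cancel_epi e.inv]
    ext i
    simpa using h i
  obtain ⟨i, hi⟩ := this
  have := hZ i
  have := isIso_of_hom_simple hi
  exact ⟨inv ((biproduct.ι Z i ≫ e.inv) ≫ f) ≫ (biproduct.ι Z i ≫ e.inv), by
    rw [Category.assoc, IsIso.inv_hom_id]⟩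

/-- A non-zero object has a simple direct summand. -/
lemma exists_simple_retract {X : C} (hX : ¬ IsZero X) :
    ∃ Y : C, Simple Y ∧ Nonempty (Retract Y X) := by
  obtain ⟨n, Z, hZ, ⟨e⟩⟩ := IsSemisimpleTensor.semisimple F X
  rcases n with _ | n
  · refine absurd ?_ hX
    rw [IsZero.iff_id_eq_zero, ← cancel_mono e.hom]
    ext i
    exact i.elim0
  · exact ⟨Z 0, hZ 0, ⟨⟨biproduct.ι Z 0 ≫ e.inv, e.hom ≫ biproduct.π Z 0, by simp⟩⟩⟩

lemma id_unit_ne_zero : 𝟙 (𝟙_ C) ≠ 0 := by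
  intro h
  have := (IsSemisimpleTensor.end_unit (F := F) (C := C)).1 (a₁ := 0) (a₂ := 1) (by simp [h])
  exact zero_ne_one this

lemma exists_smul_id_unit (f : 𝟙_ C ⟶ 𝟙_ C) : ∃ a : F, f = a • 𝟙 (𝟙_ C) := by
  obtain ⟨a, ha⟩ := (IsSemisimpleTensor.end_unit (F := F) (C := C)).2 f
  exact ⟨a, ha.symm⟩

lemma simple_unit : Simple (𝟙_ C) := by
  obtain ⟨Y, hY, ⟨r⟩⟩ := exists_simple_retract F (X := 𝟙_ C)
    (fun h => id_unit_ne_zero F (h.eq_of_src _ _))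
  obtain ⟨e⟩ := nonempty_iso_of_retract_of_end (exists_smul_id_unit F) (id_nonzero Y) r
  exact Simple.of_iso e.symm

/-- An object all of whose endomorphisms are scalars is simple or zero. -/
lemma simple_of_end {X : C} (hX0 : ¬ IsZero X) (hX : ∀ f : X ⟶ X, ∃ a : F, f = a • 𝟙 X) :
    Simple X := by
  obtain ⟨Y, hY, ⟨r⟩⟩ := exists_simple_retract F hX0
  obtain ⟨e⟩ := nonempty_iso_of_retract_of_end hX (id_nonzero Y) r
  exact Simple.of_iso e.symm

lemma end_simple [IsAlgClosed F] {X : C} [Simple X] (f : X ⟶ X) : ∃ a : F, f = a • 𝟙 X := by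
  have := finiteDimensional_hom F X X
  obtain ⟨c, hc⟩ := endomorphism_simple_eq_smul_id F f
  exact ⟨c, hc.symm⟩

lemma unitScalar_smul (f : 𝟙_ C ⟶ 𝟙_ C) : unitScalar F f • 𝟙 (𝟙_ C) = f :=
  ((IsSemisimpleTensor.end_unit (F := F) (C := C)).2 f).choose_spec

lemma unitScalar_eq {f : 𝟙_ C ⟶ 𝟙_ C} {a : F} (h : f = a • 𝟙 (𝟙_ C)) : unitScalar F f = a :=
  (IsSemisimpleTensor.end_unit (F := F) (C := C)).1 (by
    exact (unitScalar_smul F f).trans h)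

end Semisimple

section Rigid

variable (F : Type u) [Field F]
variable {C : Type w} [Category.{v} C] [Abelian C] [Linear F C] [MonoidalCategory C]
  [MonoidalPreadditive C] [IsSemisimpleTensor F C]

-- The evaluation of `X` is non-zero with simple target, hence split, so the identity of `Y` factors
-- through `Xᘁ ⊗ (X ⊗ Y)`.
include F in
lemma not_isZero_tensor [RightRigidCategory C] {X Y : C} (hX : ¬ IsZero X) (hY : ¬ IsZero Y) :
    ¬ IsZero (X ⊗ Y) := by
  intro h
  have := simple_unit F (C := C)
  obtain ⟨s, hs⟩ := exists_comp_eq_id_of_simple_target F (evaluation_ne_zero (X' := Xᘁ) hX)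
  apply hY
  rw [IsZero.iff_id_eq_zero]
  have h1 : 𝟙 (X ⊗ Y) = 0 := h.eq_of_src _ _
  have h2 : 𝟙 Y = (λ_ Y).inv ≫ s ▷ Y ≫ (α_ _ _ _).hom ≫ Xᘁ ◁ 𝟙 (X ⊗ Y) ≫ (α_ _ _ _).inv ≫
      ε_ X Xᘁ ▷ Y ≫ (λ_ Y).hom := by
    simp [← comp_whiskerRight_assoc, hs]
  rw [h2, h1]
  simp

end Rigid

end GradedBTC
end

noncomputable section

namespace GradedBTC

attribute [local instance] Abelian.hasFiniteBiproducts

/-! ### Braidings, traces and dimensions -/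

section Braided

variable {C : Type w} [Category.{v} C] [MonoidalCategory C] [BraidedCategory C]

lemma whiskerLeft_comp_rightUnitor_eq_braiding (X : C) {Y : C} (e : Y ⟶ 𝟙_ C) :
    X ◁ e ≫ (ρ_ X).hom = (β_ X Y).hom ≫ e ▷ X ≫ (λ_ X).hom := by
  rw [← BraidedCategory.braiding_naturality_right_assoc]
  simp

/-- Sliding the evaluation of `A` past `X`. -/
lemma braiding_comp_evaluation {A A' X : C} [ExactPairing A A']
    (h : (β_ A X).hom ≫ (β_ X A).hom = 𝟙 (A ⊗ X)) :
    A ◁ (β_ X A').hom ⊗≫ ((β_ A A').hom ≫ ε_ A A') ▷ X ⊗≫ 𝟙 X =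
      𝟙 _ ⊗≫ (β_ A X).hom ▷ A' ⊗≫ X ◁ ((β_ A A').hom ≫ ε_ A A') ⊗≫ 𝟙 X := by
  have h1 : X ◁ ((β_ A A').hom ≫ ε_ A A') ⊗≫ 𝟙 X = (β_ X (A ⊗ A')).hom ≫
      ((β_ A A').hom ≫ ε_ A A') ▷ X ⊗≫ 𝟙 X := by
    simpa [monoidalComp] using whiskerLeft_comp_rightUnitor_eq_braiding X ((β_ A A').hom ≫ ε_ A A')
  calc
    _ = 𝟙 _ ⊗≫ ((β_ A X).hom ≫ (β_ X A).hom) ▷ A' ⊗≫ A ◁ (β_ X A').hom ⊗≫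
        ((β_ A A').hom ≫ ε_ A A') ▷ X ⊗≫ 𝟙 X := by rw [h]; monoidal
    _ = 𝟙 _ ⊗≫ (β_ A X).hom ▷ A' ⊗≫ (β_ X (A ⊗ A')).hom ≫
        ((β_ A A').hom ≫ ε_ A A') ▷ X ⊗≫ 𝟙 X := by
      rw [BraidedCategory.braiding_tensor_right_hom]; monoidal
    _ = 𝟙 _ ⊗≫ (β_ A X).hom ▷ A' ⊗≫ (X ◁ ((β_ A A').hom ≫ ε_ A A') ⊗≫ 𝟙 X) := by rw [h1]
    _ = _ := by monoidal

/-- The loop of `X` can be closed inside the loop of `A`: the strands of `A` and `X` are unlinked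
because their double braiding is trivial. This makes the dimension multiplicative. -/
lemma braiding_comp_evaluation_tensor {A A' X X' : C} [ExactPairing A A'] [ExactPairing X X']
    (h : (β_ A X).hom ≫ (β_ X A).hom = 𝟙 (A ⊗ X)) :
    (β_ (A ⊗ X) (X' ⊗ A')).hom ≫ ε_ (A ⊗ X) (X' ⊗ A') =
      𝟙 _ ⊗≫ A ◁ ((β_ X X').hom ≫ ε_ X X') ▷ A' ⊗≫ (β_ A A').hom ≫ ε_ A A' := by
  have h1 : A ◁ ε_ X X' ⊗≫ 𝟙 A = 𝟙 _ ⊗≫ (β_ A X').hom ▷ X ⊗≫ X' ◁ (β_ A X).hom ⊗≫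
      ε_ X X' ▷ A ⊗≫ 𝟙 A := by
    have : A ◁ ε_ X X' ⊗≫ 𝟙 A = (β_ A (X' ⊗ X)).hom ≫ ε_ X X' ▷ A ⊗≫ 𝟙 A := by
      simpa [monoidalComp] using whiskerLeft_comp_rightUnitor_eq_braiding A (ε_ X X')
    rw [this, BraidedCategory.braiding_tensor_right_hom]
    monoidal
  calc
    _ = 𝟙 _ ⊗≫ A ◁ (β_ X X').hom ▷ A' ⊗≫ (A ◁ X' ◁ (β_ X A').hom ⊗≫
        (β_ A X').hom ▷ (A' ⊗ X)) ⊗≫ X' ◁ ((β_ A A').hom ≫ ε_ A A') ▷ X ⊗≫ ε_ X X' := by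
      rw [BraidedCategory.braiding_tensor_left_hom, BraidedCategory.braiding_tensor_right_hom,
        BraidedCategory.braiding_tensor_right_hom, ExactPairing.tensor_evaluation]
      monoidal
    _ = 𝟙 _ ⊗≫ A ◁ (β_ X X').hom ▷ A' ⊗≫ ((A ⊗ X') ◁ (β_ X A').hom ≫
        (β_ A X').hom ▷ (A' ⊗ X)) ⊗≫ X' ◁ ((β_ A A').hom ≫ ε_ A A') ▷ X ⊗≫ ε_ X X' := by
      monoidal
    _ = 𝟙 _ ⊗≫ A ◁ (β_ X X').hom ▷ A' ⊗≫ (β_ A X').hom ▷ (X ⊗ A') ⊗≫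
        X' ◁ (A ◁ (β_ X A').hom ⊗≫ ((β_ A A').hom ≫ ε_ A A') ▷ X ⊗≫ 𝟙 X) ⊗≫ ε_ X X' := by
      rw [whisker_exchange]; monoidal
    _ = 𝟙 _ ⊗≫ A ◁ (β_ X X').hom ▷ A' ⊗≫ (β_ A X').hom ▷ (X ⊗ A') ⊗≫
        X' ◁ (β_ A X).hom ▷ A' ⊗≫ ((X' ⊗ X) ◁ ((β_ A A').hom ≫ ε_ A A') ≫
          ε_ X X' ▷ 𝟙_ C) ⊗≫ 𝟙 _ := by
      rw [braiding_comp_evaluation h]; monoidal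
    _ = 𝟙 _ ⊗≫ A ◁ (β_ X X').hom ▷ A' ⊗≫ (𝟙 (A ⊗ X' ⊗ X) ⊗≫ (β_ A X').hom ▷ X ⊗≫
        X' ◁ (β_ A X).hom ⊗≫ ε_ X X' ▷ A ⊗≫ 𝟙 A) ▷ A' ⊗≫ (β_ A A').hom ≫ ε_ A A' := by
      rw [whisker_exchange]; monoidal
    _ = _ := by rw [← h1]; monoidal

end Braided

section Trace

variable {C : Type w} [Category.{v} C] [MonoidalCategory C] [BraidedCategory C]
  [RightRigidCategory C] [RibbonCategory C]

lemma twist_nat {X Y : C} (f : X ⟶ Y) : f ≫ (twist Y).hom = (twist X).hom ≫ f :=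
  RibbonCategory.twist_naturality f

/-- The trace of an endomorphism of `X`, computed with a given dual `X'` of `X`. -/
def pairingTrace (X X' : C) [ExactPairing X X'] (f : X ⟶ X) : 𝟙_ C ⟶ 𝟙_ C :=
  η_ X X' ≫ f ▷ X' ≫ (twist X).hom ▷ X' ≫ (β_ X X').hom ≫ ε_ X X'

lemma pairingTrace_id (X : C) : pairingTrace X Xᘁ (𝟙 X) = dimEnd X := by
  simp [pairingTrace, dimEnd, evalRibbon]

/-- Cyclicity of the trace, by sliding `f` around the loop as its mate. Allowing different duals on
the two sides also gives independence of the dual, taking `f` and `g` to be identities. -/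
lemma pairingTrace_comp_comm {X Y : C} (X' Y' : C) [ExactPairing X X'] [ExactPairing Y Y']
    (f : X ⟶ Y) (g : Y ⟶ X) : pairingTrace X X' (f ≫ g) = pairingTrace Y Y' (g ≫ f) := by
  obtain ⟨m, h1, h2⟩ : ∃ m : Y' ⟶ X', η_ X X' ≫ f ▷ X' = η_ Y Y' ≫ Y ◁ m ∧
      m ▷ X ≫ ε_ X X' = Y' ◁ f ≫ ε_ Y Y' := by
    -- The mate is formed with the given duals, not with those supplied by rigidity.
    let hX : HasRightDual X := ⟨X'⟩
    let hY : HasRightDual Y := ⟨Y'⟩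
    exact ⟨rightAdjointMate f, (coevaluation_comp_rightAdjointMate f).symm,
      rightAdjointMate_comp_evaluation f⟩
  simp only [pairingTrace, comp_whiskerRight, Category.assoc]
  rw [reassoc_of% h1, whisker_exchange_assoc, whisker_exchange_assoc,
    BraidedCategory.braiding_naturality_right_assoc, h2,
    ← BraidedCategory.braiding_naturality_left_assoc, ← comp_whiskerRight_assoc (twist X).hom,
    ← twist_nat, comp_whiskerRight_assoc]

lemma dimEnd_eq_pairingTrace (X X' : C) [ExactPairing X X'] :
    dimEnd X = pairingTrace X X' (𝟙 X) := by
  have := pairingTrace_comp_comm Xᘁ X' (𝟙 X) (𝟙 X)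
  rwa [Category.comp_id, pairingTrace_id] at this

lemma dimEnd_eq_of_iso {X Y : C} (e : X ≅ Y) : dimEnd X = dimEnd Y := by
  rw [← pairingTrace_id, ← pairingTrace_id, ← e.hom_inv_id, ← e.inv_hom_id]
  exact pairingTrace_comp_comm _ _ _ _

/-- The partial trace of the self-braiding is the twist. -/
lemma partialTrace_braiding (X : C) : partialTrace X X (β_ X X).hom = (twist X).hom := by
  -- The twist is moved to the other strand; by the hexagon in `h2` the remaining braidings assemble
  -- into that of `X` with `X ⊗ Xᘁ`, past which the coevaluation slides until the zigzag identity
  -- applies.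
  have h1 : (β_ X X).hom ▷ Xᘁ ≫ (α_ X X Xᘁ).hom ≫ X ◁ ((twist X).hom ▷ Xᘁ) =
      (α_ X X Xᘁ).hom ≫ (twist X).hom ▷ (X ⊗ Xᘁ) ≫ (α_ X X Xᘁ).inv ≫ (β_ X X).hom ▷ Xᘁ ≫
        (α_ X X Xᘁ).hom := by
    simp only [← associator_naturality_middle, whiskerRight_tensor, Category.assoc,
      Iso.hom_inv_id_assoc, ← comp_whiskerRight_assoc, BraidedCategory.braiding_naturality_left]
  have h2 : (α_ X X Xᘁ).inv ≫ (β_ X X).hom ▷ Xᘁ ≫ (α_ X X Xᘁ).hom ≫ X ◁ (β_ X Xᘁ).hom =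
      (β_ X (X ⊗ Xᘁ)).hom ≫ (α_ X Xᘁ X).hom := by
    rw [BraidedCategory.braiding_tensor_right_hom]; simp
  simp only [partialTrace, evalRibbon, MonoidalCategory.whiskerLeft_comp, Category.assoc]
  rw [reassoc_of% h1, Iso.inv_hom_id_assoc, reassoc_of% h2, whisker_exchange_assoc,
    BraidedCategory.braiding_naturality_right_assoc,
    ExactPairing.evaluation_coevaluation_assoc]
  simp

lemma pairingTrace_tensor_id {A A' X X' : C} [ExactPairing A A'] [ExactPairing X X']
    (h : (β_ A X).hom ≫ (β_ X A).hom = 𝟙 (A ⊗ X)) (hA : (twist A).hom = 𝟙 A)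
    (hX : (twist X).hom = 𝟙 X) :
    pairingTrace (A ⊗ X) (X' ⊗ A') (𝟙 _) =
      η_ A A' ≫ ((ρ_ A).inv ≫ A ◁ pairingTrace X X' (𝟙 X) ≫ (ρ_ A).hom) ▷ A' ≫
        (β_ A A').hom ≫ ε_ A A' := by
  have ht : (twist (A ⊗ X)).hom = 𝟙 _ := by
    rw [twist, RibbonCategory.twist_tensor]
    change ((twist A).hom ⊗ₘ (twist X).hom) ≫ _ = _
    rw [h, hA, hX]; simp
  rw [pairingTrace, ht, pairingTrace, hX, id_whiskerRight, Category.id_comp, id_whiskerRight,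
    Category.id_comp, braiding_comp_evaluation_tensor h, ExactPairing.tensor_coevaluation]
  simp only [Category.id_comp]
  monoidal

end Trace

section Dimension

variable (F : Type u) [Field F]
variable {C : Type w} [Category.{v} C] [Abelian C] [Linear F C] [MonoidalCategory C]
  [MonoidalPreadditive C] [MonoidalLinear F C] [BraidedCategory C] [RightRigidCategory C]
  [RibbonCategory C] [IsSemisimpleTensor F C]

lemma dimEnd_eq_smul (X : C) : dimEnd X = dim F X • 𝟙 (𝟙_ C) :=
  (unitScalar_smul F _).symm

lemma dim_eq_of_iso {X Y : C} (e : X ≅ Y) : dim F X = dim F Y := by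
  rw [dim, dim, dimEnd_eq_of_iso e]

lemma partialTrace_whiskerRight (A X : C) (g : A ⟶ A) :
    partialTrace A X (g ▷ X) = dim F X • g := by
  have h : A ◁ η_ X Xᘁ ≫ A ◁ evalRibbon X = dim F X • 𝟙 _ := by
    rw [← MonoidalCategory.whiskerLeft_comp]
    change A ◁ dimEnd X = _
    rw [dimEnd_eq_smul F X]
    simp
  simp only [partialTrace]
  rw [associator_naturality_left_assoc, Iso.inv_hom_id_assoc,
    ← whisker_exchange_assoc, reassoc_of% h]
  simp

lemma partialTrace_id (A X : C) : partialTrace A X (𝟙 (A ⊗ X)) = dim F X • 𝟙 A := by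
  rw [← id_whiskerRight, partialTrace_whiskerRight F]

lemma partialTrace_smul (A X : C) (a : F) (f : A ⊗ X ⟶ A ⊗ X) :
    partialTrace A X (a • f) = a • partialTrace A X f := by
  simp [partialTrace]

lemma pairingTrace_sum {J : Type*} (s : Finset J) (X X' : C) [ExactPairing X X']
    (f : J → (X ⟶ X)) : pairingTrace X X' (∑ i ∈ s, f i) = ∑ i ∈ s, pairingTrace X X' (f i) := by
  simp only [pairingTrace, sum_whiskerRight, Preadditive.sum_comp, Preadditive.comp_sum]

lemma dimEnd_biproduct {n : ℕ} (Y : Fin n → C) : dimEnd (⨁ Y) = ∑ i, dimEnd (Y i) := by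
  rw [← pairingTrace_id, ← biproduct.total, pairingTrace_sum]
  refine Finset.sum_congr rfl fun i _ => ?_
  rw [pairingTrace_comp_comm _ (Y i)ᘁ, biproduct.ι_π_self, pairingTrace_id]

lemma dim_biproduct {n : ℕ} (Y : Fin n → C) : dim F (⨁ Y) = ∑ i, dim F (Y i) :=
  unitScalar_eq F (by
    rw [dimEnd_biproduct, Finset.sum_smul]
    exact Finset.sum_congr rfl fun i _ => dimEnd_eq_smul F _)

lemma dim_tensor {A X : C} (h : (β_ A X).hom ≫ (β_ X A).hom = 𝟙 (A ⊗ X))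
    (hA : (twist A).hom = 𝟙 A) (hX : (twist X).hom = 𝟙 X) :
    dim F (A ⊗ X) = dim F X * dim F A := by
  refine unitScalar_eq F ?_
  rw [dimEnd_eq_pairingTrace (A ⊗ X) (Xᘁ ⊗ Aᘁ), pairingTrace_tensor_id h hA hX, pairingTrace_id,
    dimEnd_eq_smul F X]
  have : η_ A Aᘁ ≫ (β_ A Aᘁ).hom ≫ ε_ A Aᘁ = dim F A • 𝟙 (𝟙_ C) := by
    rw [← dimEnd_eq_smul, dimEnd, evalRibbon, hA]
    simp
  simp [this, mul_smul]

/-- By duality these morphisms correspond to endomorphisms of `X`, which are scalars. -/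
lemma exists_smul_evaluation [IsAlgClosed F] {X X' : C} [ExactPairing X X'] [Simple X]
    (r : X' ⊗ X ⟶ 𝟙_ C) : ∃ a : F, r = a • ε_ X X' := by
  obtain ⟨a, ha⟩ := end_simple F (tensorLeftHomEquiv X X X' (𝟙_ C) r ≫ (ρ_ X).hom)
  have h2 : tensorLeftHomEquiv X X X' (𝟙_ C) r = a • (ρ_ X).inv := by
    rw [← cancel_mono (ρ_ X).hom, ha]; simp
  refine ⟨a, ?_⟩
  rw [(Equiv.eq_symm_apply _).2 h2]
  simp [tensorLeftHomEquiv, unitors_equal]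

/-- The dimension of a simple object is non-zero. -/
lemma dim_ne_zero [IsAlgClosed F] (X : C) [Simple X] : dim F X ≠ 0 := by
  have h1 := simple_unit F (C := C)
  -- A retraction of the coevaluation must be a multiple of the ribbon evaluation, so some multiple
  -- of `dim F X` equals 1.
  obtain ⟨r, hr⟩ := exists_comp_eq_id_of_simple_source F
    (coevaluation_ne_zero (X' := Xᘁ) (not_isZero_of_simple X))
  obtain ⟨a, ha⟩ := exists_smul_evaluation F ((β_ X Xᘁ).inv ≫ (twist X).inv ▷ Xᘁ ≫ r)
  have h4 : r = a • evalRibbon X := by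
    rw [evalRibbon, ← Linear.comp_smul, ← Linear.comp_smul, ← ha]
    simp
  intro h0
  rw [h4, Linear.comp_smul] at hr
  change a • dimEnd X = _ at hr
  rw [dimEnd_eq_smul F, h0, zero_smul, smul_zero] at hr
  exact id_unit_ne_zero F hr.symm

/-- Duality embeds the endomorphisms of `Xᘁ` into the morphisms `Xᘁ ⊗ X ⟶ 𝟙_ C`, all of which are
multiples of the evaluation. -/
lemma simple_rightDual [IsAlgClosed F] (X : C) [Simple X] : Simple (Xᘁ) := by
  refine simple_of_end F (fun h => evaluation_ne_zero (X' := Xᘁ) (not_isZero_of_simple X) ?_)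
    fun f => ?_
  · have : 𝟙 (Xᘁ) = 0 := h.eq_of_src _ _
    rw [← Category.id_comp (ε_ X Xᘁ), ← id_whiskerRight, this]
    simp
  · obtain ⟨a, ha⟩ := exists_smul_evaluation F (f ▷ X ≫ ε_ X Xᘁ)
    refine ⟨a, ?_⟩
    have h1 : ∀ g : Xᘁ ⟶ Xᘁ, (tensorRightHomEquiv Xᘁ X Xᘁ (𝟙_ C)).symm (g ≫ (λ_ _).inv) =
        g ▷ X ≫ ε_ X Xᘁ := fun g => by
      simp only [tensorRightHomEquiv, Equiv.coe_fn_symm_mk]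
      monoidal
    have h2 : f ≫ (λ_ _).inv = (a • 𝟙 (Xᘁ)) ≫ (λ_ _).inv := by
      apply (tensorRightHomEquiv Xᘁ X Xᘁ (𝟙_ C)).symm.injective
      rw [h1, h1, ha]
      simp
    exact (cancel_mono _).1 h2

end Dimension

end GradedBTC
end

noncomputable section

namespace GradedBTC

attribute [local instance] Abelian.hasFiniteBiproducts

/-! ### Invertibility of the simple objects -/

section Invertible

variable (F : Type u) [Field F]
variable {C : Type w} [Category.{v} C] [Abelian C] [Linear F C] [MonoidalCategory C]
  [MonoidalPreadditive C] [MonoidalLinear F C] [BraidedCategory C] [RightRigidCategory C]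
  [RibbonCategory C] [IsSemisimpleTensor F C]

-- Since the evaluation of `Y` is a split epimorphism, `f` is recovered from `Yᘁ ◁ Y ◁ f`.
include F in
lemma eq_of_whiskerLeft_eq {Y : C} (hY : ¬ IsZero Y) {A B : C} {f g : A ⟶ B}
    (h : Y ◁ f = Y ◁ g) : f = g := by
  have := simple_unit F (C := C)
  obtain ⟨s, hs⟩ := exists_comp_eq_id_of_simple_target F (evaluation_ne_zero (X' := Yᘁ) hY)
  have key : ∀ f : A ⟶ B, f = (λ_ A).inv ≫ s ▷ A ≫ (α_ _ _ _).hom ≫ Yᘁ ◁ Y ◁ f ≫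
      (α_ _ _ _).inv ≫ ε_ Y Yᘁ ▷ B ≫ (λ_ B).hom := fun f => by
    rw [associator_inv_naturality_right_assoc, Iso.hom_inv_id_assoc, whisker_exchange_assoc,
      ← comp_whiskerRight_assoc, hs]
    simp
  rw [key f, key g, h]

include F in
lemma eq_of_whiskerRight_eq {Y : C} (hY : ¬ IsZero Y) {A B : C} {f g : A ⟶ B}
    (h : f ▷ Y = g ▷ Y) : f = g := by
  refine eq_of_whiskerLeft_eq F hY ?_
  rw [← cancel_epi (β_ A Y).hom, ← BraidedCategory.braiding_naturality_left,
    ← BraidedCategory.braiding_naturality_left, h]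

/-- Tensoring with an invertible object preserves simple objects. -/
lemma simple_tensor_of_isIso_coevaluation [IsAlgClosed F] {A X : C} [IsIso (η_ A Aᘁ)]
    (hA : ¬ IsZero A) (hX : Simple X) : Simple (A ⊗ X) := by
  refine simple_of_end F (not_isZero_tensor F hA (not_isZero_of_simple X)) fun f => ?_
  -- Tensoring with the dual undoes tensoring with `A`, so `Aᘁ ◁ f` is conjugate to an endomorphism
  -- of the simple object `X`.
  let e : X ≅ Aᘁ ⊗ (A ⊗ X) := (λ_ X).symm ≪≫ whiskerRightIso (asIso (η_ A Aᘁ) ≪≫ β_ A Aᘁ) X ≪≫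
    α_ _ _ _
  obtain ⟨a, ha⟩ := end_simple F (e.hom ≫ Aᘁ ◁ f ≫ e.inv)
  refine ⟨a, eq_of_whiskerLeft_eq F (Y := Aᘁ) (fun h => ?_) ?_⟩
  · have h0 : 𝟙 (Aᘁ) = 0 := h.eq_of_src _ _
    refine evaluation_ne_zero (X' := Aᘁ) hA ?_
    rw [← Category.id_comp (ε_ A Aᘁ), ← id_whiskerRight, h0]
    simp
  · rw [← cancel_epi e.hom, ← cancel_mono e.inv, Category.assoc, ha]
    simp

variable {S : ObjectProperty C}

/-- In a symmetric even subcategory all of whose simple objects have dimension one, the simple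
objects are invertible. -/
lemma isIso_coevaluation [IsAlgClosed F] [CharZero F] (hS : IsFiniteFullTensorSubcategory S)
    (hsym : IsSymmetric S) (heven : IsEven S)
    (hdim : ∀ X : C, S X → Simple X → dim F X = 1) {X : C} (hX : S X) [Simple X] :
    IsIso (η_ X Xᘁ) := by
  have hX' := hS.dual hX
  obtain ⟨n, Y, hY, ⟨e⟩⟩ := IsSemisimpleTensor.semisimple F (X ⊗ Xᘁ)
  have hYS : ∀ i, S (Y i) := fun i =>
    hS.summand (X := X ⊗ Xᘁ) ⟨biproduct.ι Y i ≫ e.inv, e.hom ≫ biproduct.π Y i, by simp⟩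
      (hS.tensor hX hX')
  have h1 : dim F (X ⊗ Xᘁ) = 1 := by
    rw [dim_tensor F (hsym _ _ hX hX') (heven _ hX) (heven _ hX'), hdim X hX inferInstance,
      hdim _ hX' (simple_rightDual F X), mul_one]
  have h2 : dim F (X ⊗ Xᘁ) = n := by
    rw [dim_eq_of_iso F e, dim_biproduct, Finset.sum_congr rfl fun i _ => hdim _ (hYS i) (hY i)]
    simp
  -- The number of simple summands equals 1 in `F`, hence in `ℕ` by characteristic zero.
  have h3 : n = 1 := by exact_mod_cast h2.symm.trans h1
  subst h3
  have := simple_unit F (C := C)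
  have := hY default
  have : Simple (X ⊗ Xᘁ) := Simple.of_iso (e ≪≫ biproductUniqueIso Y)
  exact isIso_of_hom_simple (coevaluation_ne_zero (not_isZero_of_simple X))

/-- As `X ⊗ X` is simple, the self-braiding is a scalar `a`; its partial trace is `a` times the
dimension 1 on one hand and the trivial twist on the other. -/
lemma braiding_self_eq_id [IsAlgClosed F] {X : C} [Simple X] [IsIso (η_ X Xᘁ)]
    (hd : dim F X = 1) (ht : (twist X).hom = 𝟙 X) : (β_ X X).hom = 𝟙 (X ⊗ X) := by
  have := simple_tensor_of_isIso_coevaluation F (not_isZero_of_simple X) ‹Simple X›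
  obtain ⟨a, ha⟩ := end_simple F (β_ X X).hom
  have h := partialTrace_braiding X
  rw [ha, partialTrace_smul, partialTrace_id F, hd, one_smul, ht] at h
  have : a = 1 := smul_id_injective (not_isZero_of_simple X) (by rw [h, one_smul])
  rw [ha, this, one_smul]

lemma dim_eq_one_of_braiding_self {X : C} (hX : ¬ IsZero X) (hb : (β_ X X).hom = 𝟙 (X ⊗ X))
    (ht : (twist X).hom = 𝟙 X) : dim F X = 1 := by
  have h := partialTrace_braiding X
  rw [hb, partialTrace_id F, ht] at h
  exact smul_id_injective hX (by rw [h, one_smul])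

end Invertible

/-! ### The double braiding -/

section DoubleBraiding

variable (F : Type u) [Field F]
variable {C : Type w} [Category.{v} C] [Abelian C] [Linear F C] [MonoidalCategory C]
  [MonoidalPreadditive C] [MonoidalLinear F C] [BraidedCategory C] [RightRigidCategory C]
  [RibbonCategory C] [IsSemisimpleTensor F C]

lemma doubleBraiding_naturality_left {A B : C} (f : A ⟶ B) (X : C) :
    f ▷ X ≫ doubleBraiding B X = doubleBraiding A X ≫ f ▷ X := by
  simp [doubleBraiding]

lemma doubleBraiding_naturality_right (A : C) {X Y : C} (f : X ⟶ Y) :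
    A ◁ f ≫ doubleBraiding A Y = doubleBraiding A X ≫ A ◁ f := by
  simp [doubleBraiding]

lemma doubleBraiding_unit_left (X : C) : doubleBraiding (𝟙_ C) X = 𝟙 _ := by
  simp [doubleBraiding]

lemma doubleBraiding_unit_right (A : C) : doubleBraiding A (𝟙_ C) = 𝟙 _ := by
  simp [doubleBraiding]

/-- By the hexagon, `X` goes around `A` and `B` one after the other. Applied to `Γ ⊗ Γ`, this makes
the degree a monoid endomorphism. -/
lemma doubleBraiding_tensor_left {A B X : C} {f : A ⟶ A} {g : B ⟶ B}
    (hf : doubleBraiding A X = f ▷ X) (hg : doubleBraiding B X = g ▷ X) :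
    doubleBraiding (A ⊗ B) X = (f ⊗ₘ g) ▷ X := by
  calc
    _ = 𝟙 _ ⊗≫ A ◁ (β_ B X).hom ⊗≫ (doubleBraiding A X) ▷ B ⊗≫ A ◁ (β_ X B).hom ⊗≫ 𝟙 _ := by
      rw [doubleBraiding, doubleBraiding, BraidedCategory.braiding_tensor_left_hom,
        BraidedCategory.braiding_tensor_right_hom]
      monoidal
    _ = 𝟙 _ ⊗≫ (A ◁ (β_ B X).hom ≫ f ▷ (X ⊗ B)) ⊗≫ A ◁ (β_ X B).hom ⊗≫ 𝟙 _ := by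
      rw [hf]; monoidal
    _ = 𝟙 _ ⊗≫ f ▷ (B ⊗ X) ⊗≫ A ◁ (doubleBraiding B X) ⊗≫ 𝟙 _ := by
      rw [whisker_exchange, doubleBraiding]; monoidal
    _ = _ := by rw [hg, MonoidalCategory.tensorHom_def]; monoidal

/-- By the hexagon, `A` goes around `Y` inside its loop around `X`. The order `g ≫ f` is the product
`f * g` in `End A`, which gives multiplicativity of the degree. -/
lemma doubleBraiding_tensor_right {A X Y : C} {f g : A ⟶ A}
    (hf : doubleBraiding A X = f ▷ X) (hg : doubleBraiding A Y = g ▷ Y) :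
    doubleBraiding A (X ⊗ Y) = (g ≫ f) ▷ (X ⊗ Y) := by
  calc
    _ = 𝟙 _ ⊗≫ (β_ A X).hom ▷ Y ⊗≫ X ◁ (doubleBraiding A Y) ⊗≫ (β_ X A).hom ▷ Y ⊗≫ 𝟙 _ := by
      rw [doubleBraiding, doubleBraiding, BraidedCategory.braiding_tensor_left_hom,
        BraidedCategory.braiding_tensor_right_hom]
      monoidal
    _ = 𝟙 _ ⊗≫ ((β_ A X).hom ≫ X ◁ g) ▷ Y ⊗≫ (β_ X A).hom ▷ Y ⊗≫ 𝟙 _ := by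
      rw [hg]; monoidal
    _ = 𝟙 _ ⊗≫ g ▷ (X ⊗ Y) ⊗≫ (doubleBraiding A X) ▷ Y ⊗≫ 𝟙 _ := by
      rw [← BraidedCategory.braiding_naturality_left, doubleBraiding]; monoidal
    _ = _ := by rw [hf]; monoidal

lemma exists_doubleBraiding_eq_of_biproduct {n : ℕ} {A X : C} (Y : Fin n → C) (e : A ≅ ⨁ Y)
    (h : ∀ i, ∃ g : Y i ⟶ Y i, doubleBraiding (Y i) X = g ▷ X) :
    ∃ g : A ⟶ A, doubleBraiding A X = g ▷ X := by
  choose g hg using h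
  refine ⟨∑ i, (e.hom ≫ biproduct.π Y i) ≫ g i ≫ biproduct.ι Y i ≫ e.inv, ?_⟩
  rw [← Category.id_comp (doubleBraiding A X), ← id_whiskerRight, id_eq_sum_of_iso_biproduct e, sum_whiskerRight,
    sum_whiskerRight, Preadditive.sum_comp]
  refine Finset.sum_congr rfl fun i _ => ?_
  rw [comp_whiskerRight, Category.assoc, doubleBraiding_naturality_left, hg]
  simp

end DoubleBraiding

end GradedBTC
end

noncomputable section

namespace GradedBTC

/-! ### Computing with representations through pure tensors -/

section FDRep

open TensorProduct

variable {F G : Type u} [Field F] [Group G]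

/-- The linear map underlying a morphism of representations. -/
def repLin {V W : FDRep F G} (f : V ⟶ W) : V →ₗ[F] W := f.hom.hom.hom

lemma repLin_injective {V W : FDRep F G} {f g : V ⟶ W} (h : ∀ v, repLin f v = repLin g v) :
    f = g := by
  apply Action.hom_ext
  ext v
  exact h v

lemma repLin_ρ {V W : FDRep F G} (f : V ⟶ W) (g : G) (v : V) :
    repLin f (V.ρ g v) = W.ρ g (repLin f v) :=
  ConcreteCategory.congr_hom ((CategoryTheory.forget (FGModuleCat F)).congr_map (f.comm g)) v

/-- An equivariant linear map as a morphism of representations. -/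
def repHom {V W : FDRep F G} (f : V →ₗ[F] W) (h : ∀ g v, f (V.ρ g v) = W.ρ g (f v)) : V ⟶ W where
  hom := InducedCategory.homMk (ModuleCat.ofHom f)
  comm g := by
    ext v
    exact h g v

@[simp] lemma repLin_repHom {V W : FDRep F G} (f : V →ₗ[F] W)
    (h : ∀ g v, f (V.ρ g v) = W.ρ g (f v)) : repLin (repHom f h) = f := rfl

@[simp] lemma repLin_id (V : FDRep F G) (v : V) : repLin (𝟙 V) v = v := rfl

@[simp] lemma repLin_comp {U V W : FDRep F G} (f : U ⟶ V) (g : V ⟶ W) (u : U) :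
    repLin (f ≫ g) u = repLin g (repLin f u) := rfl

@[simp] lemma repLin_add {V W : FDRep F G} (f g : V ⟶ W) :
    repLin (f + g) = repLin f + repLin g := rfl

@[simp] lemma repLin_smul {V W : FDRep F G} (a : F) (f : V ⟶ W) :
    repLin (a • f) = a • repLin f := rfl

/-- The pure tensors of a tensor product of representations. -/
def repTmul (V W : FDRep F G) : V →ₗ[F] W →ₗ[F] (V ⊗ W : FDRep F G) := TensorProduct.mk F V W

lemma repTmul_ext {V W : FDRep F G} {U : Type*} [AddCommGroup U] [Module F U]
    {f g : (V ⊗ W : FDRep F G) →ₗ[F] U}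
    (h : ∀ v w, f (repTmul V W v w) = g (repTmul V W v w)) : f = g :=
  TensorProduct.ext' h

lemma repTmul_ρ (V W : FDRep F G) (g : G) (v : V) (w : W) :
    (V ⊗ W).ρ g (repTmul V W v w) = repTmul V W (V.ρ g v) (W.ρ g w) := rfl

@[simp] lemma repLin_whiskerRight {V W V' : FDRep F G} (f : V ⟶ V') (v : V) (w : W) :
    repLin (f ▷ W) (repTmul V W v w) = repTmul V' W (repLin f v) w := rfl

@[simp] lemma repLin_whiskerLeft {V W W' : FDRep F G} (g : W ⟶ W') (v : V) (w : W) :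
    repLin (V ◁ g) (repTmul V W v w) = repTmul V W' v (repLin g w) := rfl

@[simp] lemma repLin_braiding (V W : FDRep F G) (v : V) (w : W) :
    repLin (β_ V W).hom (repTmul V W v w) = repTmul W V w v := rfl

@[simp] lemma repLin_associator (U V W : FDRep F G) (u : U) (v : V) (w : W) :
    repLin (α_ U V W).hom (repTmul (U ⊗ V) W (repTmul U V u v) w) =
      repTmul U (V ⊗ W) u (repTmul V W v w) := rfl

/-- The generator of the unit representation. -/
def repOne : (𝟙_ (FDRep F G) : FDRep F G) := (1 : F)

@[simp] lemma repLin_leftUnitor (V : FDRep F G) (v : V) :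
    repLin (λ_ V).hom (repTmul (𝟙_ (FDRep F G)) V repOne v) = v := one_smul F v

@[simp] lemma repLin_rightUnitor (V : FDRep F G) (v : V) :
    repLin (ρ_ V).hom (repTmul V (𝟙_ (FDRep F G)) v repOne) = v := one_smul F v

lemma repOne_ρ (g : G) : (𝟙_ (FDRep F G)).ρ g repOne = (repOne : (𝟙_ (FDRep F G) : FDRep F G)) :=
  rfl

end FDRep

section CommGroup

variable {F G : Type u} [Field F] [CommGroup G]

/-- The self-braiding of a representation of an abelian group with only scalar endomorphisms is
trivial. -/
lemma braiding_self_of_end_scalar {V : FDRep F G} (h : ∀ f : V ⟶ V, ∃ a : F, f = a • 𝟙 V) :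
    (β_ V V).hom = 𝟙 (V ⊗ V) := by
  -- As `G` is abelian, each group element acts by an endomorphism of the representation, hence by a
  -- scalar. Every linear map is then equivariant and so itself a scalar (`hlin`).
  have hρ : ∀ g : G, ∃ a : F, ∀ v, V.ρ g v = a • v := fun g => by
    obtain ⟨a, ha⟩ := h (repHom (V.ρ g) fun k v => by
      rw [← Module.End.mul_apply, ← Module.End.mul_apply, ← map_mul, ← map_mul, mul_comm])
    exact ⟨a, fun v => LinearMap.congr_fun (congrArg repLin ha) v⟩
  have hlin : ∀ T : V →ₗ[F] V, ∃ a : F, ∀ v, T v = a • v := fun T => by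
    obtain ⟨a, ha⟩ := h (repHom T fun k v => by
      obtain ⟨b, hb⟩ := hρ k
      rw [hb, hb, map_smul])
    exact ⟨a, fun v => LinearMap.congr_fun (congrArg repLin ha) v⟩
  apply repLin_injective
  intro x
  refine LinearMap.congr_fun (repTmul_ext fun v w => ?_) x
  rw [repLin_braiding, repLin_id]
  by_cases hv : v = 0
  · subst hv; simp
  · obtain ⟨φ, hφ⟩ := Module.Projective.exists_dual_ne_zero F hv
    -- The rank-one map `x ↦ φ x • w` being a scalar forces `w` to be a multiple of `v`.
    obtain ⟨a, ha⟩ := hlin (φ.smulRight w)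
    have h1 : w = ((φ v)⁻¹ * a) • v := by
      rw [mul_smul, ← ha, LinearMap.smulRight_apply, smul_smul, inv_mul_cancel₀ hφ, one_smul]
    rw [h1]; simp

end CommGroup

/-! ### Endomorphisms of the regular monoid -/

section Regular

open TannakaDuality.FiniteGroup

variable {F G : Type u} [Field F] [Group G] [Finite G]

lemma regTranslation_injective : Function.Injective (regTranslation F G) := by
  classical
  intro s t h
  have h1 : ∀ f : G → F, f (1 * s) = f (1 * t) := fun f =>
    congrFun (LinearMap.congr_fun (congrArg (repLin (V := regRep F G)) h) f) 1
  by_contra hst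
  have := h1 (Pi.single s 1)
  simp [Ne.symm hst] at this

lemma regTranslation_isMonHom (s : G) : IsMonHom (M := regRep F G) (regTranslation F G s) where
  one_hom := by
    apply repLin_injective
    intro v
    rfl
  mul_hom := by
    apply repLin_injective
    intro x
    refine LinearMap.congr_fun (f := repLin _) (g := repLin _) (repTmul_ext fun v w => ?_) x
    rfl

/-- Followed by evaluation at 1, `f` is an algebra homomorphism from functions on `G` to `F`, that
is, evaluation at a point `s`. Equivariance carries this from the point 1 to every `t`. -/
lemma exists_regTranslation_eq (f : regRep F G ⟶ regRep F G) [IsMonHom f] :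
    ∃ s, regTranslation F G s = f := by
  classical
  let T : (G → F) →ₗ[F] (G → F) := repLin f
  have hone : T 1 = 1 := by
    have := LinearMap.congr_fun (congrArg repLin (IsMonHom.one_hom f)) repOne
    have h1 : repLin η[regRep F G] repOne = (1 : G → F) := by
      exact map_one (algebraMap F (G → F))
    rw [repLin_comp, h1] at this
    exact this
  have hmul : ∀ x y, T (x * y) = T x * T y := fun x y =>
    LinearMap.congr_fun (congrArg repLin (IsMonHom.mul_hom f))
      (repTmul (regRep F G) (regRep F G) x y)
  have hρ : ∀ (g : G) (x : G → F), T (leftRegular g x) = leftRegular g (T x) := fun g x =>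
    repLin_ρ f g x
  let A : (G → F) →ₐ[F] (G → F) := AlgHom.ofLinearMap T hone hmul
  obtain ⟨s, hs⟩ := ((Pi.evalAlgHom F (fun _ : G => F) 1).comp A).eq_piEvalAlgHom
  refine ⟨s, repLin_injective fun (x : G → F) => ?_⟩
  change rightRegular s x = T x
  funext t
  have h1 := DFunLike.congr_fun hs (leftRegular t⁻¹ x)
  change T (leftRegular t⁻¹ x) 1 = leftRegular t⁻¹ x s at h1
  rw [hρ] at h1
  simpa using h1.symm

end Regular

end GradedBTC
end

noncomputable section

namespace GradedBTC

attribute [local instance] Abelian.hasFiniteBiproducts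

lemma isMonHom_functor_map_iff {D : Type*} [Category* D] [MonoidalCategory D] {C : Type*}
    [Category* C] [MonoidalCategory C] (Φ : D ⥤ C) [Φ.Monoidal] [Φ.Faithful] {M : D} [MonObj M]
    (f : M ⟶ M) : letI := Φ.monObjObj M
    IsMonHom (Φ.map f) ↔ IsMonHom f := by
  let := Φ.monObjObj M
  have hη : η[Φ.obj M] = Functor.LaxMonoidal.ε Φ ≫ Φ.map η[M] := rfl
  have hμ : μ[Φ.obj M] = Functor.LaxMonoidal.μ Φ _ _ ≫ Φ.map μ[M] := rfl
  constructor
  · intro h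
    have h1 := h.one_hom
    have h2 := h.mul_hom
    rw [hη, Category.assoc, cancel_epi, ← Functor.map_comp] at h1
    rw [hμ, Category.assoc, Functor.LaxMonoidal.μ_natural_assoc, cancel_epi, ← Functor.map_comp,
      ← Functor.map_comp] at h2
    exact ⟨Φ.map_injective h1, Φ.map_injective h2⟩
  · intro h
    refine ⟨?_, ?_⟩
    · rw [hη, Category.assoc, ← Functor.map_comp, h.one_hom]
    · rw [hμ, Category.assoc, ← Functor.map_comp, h.mul_hom, Functor.LaxMonoidal.μ_natural_assoc,
        Functor.map_comp]

/-! ### Consequences of an equivalence with a representation category -/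

namespace RepEquivalence

section Basic

variable {F G : Type u} [Field F] [Group G]
variable {C : Type w} [Category.{v} C] [Abelian C] [Linear F C] [MonoidalCategory C]
  [BraidedCategory C] [RightRigidCategory C] [RibbonCategory C]
  {S : ObjectProperty C} (E : RepEquivalence F G S)

include E

lemma exists_iso {X : C} (hX : S X) : ∃ V : FDRep F G, Nonempty (E.functor.obj V ≅ X) := by
  rw [← E.essImage_eq] at hX
  exact hX

lemma mem_obj (V : FDRep F G) : S (E.functor.obj V) := by
  exact Eq.mp (congrFun E.essImage_eq _) (E.functor.obj_mem_essImage V)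

lemma braiding_obj (V W : FDRep F G) : letI := E.braided
    (β_ (E.functor.obj V) (E.functor.obj W)).hom =
      Functor.LaxMonoidal.μ E.functor V W ≫ E.functor.map (β_ V W).hom ≫
        Functor.OplaxMonoidal.δ E.functor W V := by
  let := E.braided
  rw [Functor.map_braiding]
  simp

lemma isSymmetric : IsSymmetric S := by
  let := E.braided
  intro X Y hX hY
  obtain ⟨V, ⟨e⟩⟩ := E.exists_iso hX
  obtain ⟨W, ⟨e'⟩⟩ := E.exists_iso hY
  have h : (β_ (E.functor.obj V) (E.functor.obj W)).hom ≫
      (β_ (E.functor.obj W) (E.functor.obj V)).hom = 𝟙 _ := by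
    rw [E.braiding_obj, E.braiding_obj, Category.assoc, Category.assoc,
      Functor.Monoidal.δ_μ_assoc, ← Functor.map_comp_assoc, SymmetricCategory.symmetry]
    simp
  rw [← cancel_epi (e.hom ⊗ₘ e'.hom), BraidedCategory.braiding_naturality_assoc,
    BraidedCategory.braiding_naturality, reassoc_of% h, Category.comp_id]

lemma isEven : IsEven S := by
  intro X hX
  obtain ⟨V, ⟨e⟩⟩ := E.exists_iso hX
  rw [← cancel_epi e.hom, twist_nat, E.twist_eq]
  simp

end Basic

section Dimension

variable {F G : Type u} [Field F] [IsAlgClosed F] [CommGroup G]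
variable {C : Type w} [Category.{v} C] [Abelian C] [Linear F C] [MonoidalCategory C]
  [MonoidalPreadditive C] [MonoidalLinear F C] [BraidedCategory C] [RightRigidCategory C]
  [RibbonCategory C] [IsSemisimpleTensor F C] {S : ObjectProperty C} (E : RepEquivalence F G S)

include E

/-- A representation `V` realizing `X` has only scalar endomorphisms by faithfulness, so its
self-swap is trivial. The functor carries this to the self-braiding, whose partial trace compares
the dimension with the trivial twist. -/
lemma dim_eq_one {X : C} (hX : S X) (hX' : Simple X) : dim F X = 1 := by
  let := E.braided
  have := E.linear
  have := E.faithful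
  obtain ⟨V, ⟨e⟩⟩ := E.exists_iso hX
  have hs : Simple (E.functor.obj V) := Simple.of_iso e
  have hV : ∀ f : V ⟶ V, ∃ a : F, f = a • 𝟙 V := fun f => by
    obtain ⟨a, ha⟩ := end_simple F (E.functor.map f)
    exact ⟨a, E.functor.map_injective (by rw [ha, Functor.map_smul, CategoryTheory.Functor.map_id])⟩
  rw [← dim_eq_of_iso F e]
  refine dim_eq_one_of_braiding_self F (not_isZero_of_simple _) ?_ (E.twist_eq V)
  rw [E.braiding_obj, braiding_self_of_end_scalar hV]
  simp

end Dimension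

section Translation

variable {F G : Type u} [Field F] [Group G] [Finite G]
variable {C : Type w} [Category.{v} C] [Abelian C] [Linear F C] [MonoidalCategory C]
  [BraidedCategory C] [RightRigidCategory C] [RibbonCategory C]
  {S : ObjectProperty C} (E : RepEquivalence F G S)

lemma toEnd_injective : Function.Injective E.toEnd := by
  have := E.faithful
  intro s t h
  exact regTranslation_injective (F := F) (E.functor.map_injective h)

lemma isMonHom_map_iff (f : regRep F G ⟶ regRep F G) :
    IsMonHom (M := E.Γ) (N := E.Γ) (E.functor.map f) ↔ IsMonHom f := by
  let := E.braided
  have := E.faithful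
  exact isMonHom_functor_map_iff E.functor f

lemma exists_toEnd_eq_iff (f : E.Γ ⟶ E.Γ) : (∃ g : G, E.toEnd g = f) ↔ IsMonHom f := by
  have := E.full
  constructor
  · rintro ⟨g, rfl⟩
    exact (E.isMonHom_map_iff _).2 (regTranslation_isMonHom g)
  · intro h
    obtain ⟨f, rfl⟩ := E.functor.map_surjective f
    have := (E.isMonHom_map_iff _).1 h
    obtain ⟨s, rfl⟩ := exists_regTranslation_eq f
    exact ⟨s, rfl⟩

end Translation

/-! ### The grading by the double braiding with Γ -/

section Grading

variable {F G : Type u} [Field F] [IsAlgClosed F] [CharZero F] [CommGroup G] [Finite G]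
variable {C : Type w} [Category.{v} C] [Abelian C] [Linear F C] [MonoidalCategory C]
  [MonoidalPreadditive C] [MonoidalLinear F C] [BraidedCategory C] [RightRigidCategory C]
  [RibbonCategory C] [IsSemisimpleTensor F C] {S : ObjectProperty C} (E : RepEquivalence F G S)
  (hS : IsFiniteFullTensorSubcategory S)

include E hS in
/-- The double braiding of an object of `S` with a simple object `X` acts on the first factor
only. -/
lemma exists_doubleBraiding_eq {A X : C} (hA : S A) (hX : Simple X) :
    ∃ g : A ⟶ A, doubleBraiding A X = g ▷ X := by
  obtain ⟨n, Y, hY, ⟨e⟩⟩ := IsSemisimpleTensor.semisimple F A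
  refine exists_doubleBraiding_eq_of_biproduct Y e fun i => ?_
  have hYS : S (Y i) :=
    hS.summand (X := A) ⟨biproduct.ι Y i ≫ e.inv, e.hom ≫ biproduct.π Y i, by simp⟩ hA
  have := hY i
  have := isIso_coevaluation F hS E.isSymmetric E.isEven (fun _ => E.dim_eq_one) hYS
  have := simple_tensor_of_isIso_coevaluation F (not_isZero_of_simple (Y i)) hX
  obtain ⟨a, ha⟩ := end_simple F (doubleBraiding (Y i) X)
  exact ⟨a • 𝟙 _, by rw [ha]; simp⟩

lemma normalizedTrace_eq {X : C} (hX : Simple X) {g : E.Γ ⟶ E.Γ}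
    (h : doubleBraiding E.Γ X = g ▷ X) : E.normalizedTrace X = g := by
  rw [normalizedTrace, h, partialTrace_whiskerRight F, smul_smul,
    inv_mul_cancel₀ (dim_ne_zero F X), one_smul]

-- Naturality of the double braiding with respect to the unit and the multiplication of `A` gives
-- both axioms after whiskering by `X`, which is faithful.
include F in
lemma isMonHom_of_doubleBraiding_eq {A X : C} [MonObj A] (hX : ¬ IsZero X) {g : A ⟶ A}
    (h : doubleBraiding A X = g ▷ X) : IsMonHom g := by
  constructor
  · refine eq_of_whiskerRight_eq F hX ?_
    rw [comp_whiskerRight, ← h, doubleBraiding_naturality_left, doubleBraiding_unit_left,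
      Category.id_comp]
  · refine eq_of_whiskerRight_eq F hX ?_
    rw [comp_whiskerRight, ← h, doubleBraiding_naturality_left, doubleBraiding_tensor_left h h,
      comp_whiskerRight]

include hS in
lemma exists_doubleBraiding_eq_toEnd {X : C} (hX : Simple X) :
    ∃ g : G, doubleBraiding E.Γ X = E.toEnd g ▷ X := by
  obtain ⟨f, hf⟩ := exists_doubleBraiding_eq E hS (E.mem_obj (regRep F G)) hX
  obtain ⟨g, rfl⟩ := (E.exists_toEnd_eq_iff f).2
    (isMonHom_of_doubleBraiding_eq (F := F) (not_isZero_of_simple X) hf)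
  exact ⟨g, hf⟩

include hS in
/-- Homogeneity in terms of the double braiding. -/
lemma isHomogeneousOfDegree_iff {X : C} {g : G} :
    E.IsHomogeneousOfDegree X g ↔ ¬ IsZero X ∧ doubleBraiding E.Γ X = E.toEnd g ▷ X := by
  refine and_congr_right fun hX => ⟨fun h => ?_, fun h Y hY => ?_⟩
  · obtain ⟨n, Y, hY, ⟨e⟩⟩ := IsSemisimpleTensor.semisimple F X
    have key : ∀ i, doubleBraiding E.Γ (Y i) = E.toEnd g ▷ Y i := fun i => by
      obtain ⟨k, hk⟩ := E.exists_doubleBraiding_eq_toEnd hS (hY i)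
      have := h (Y i) (hY i) ⟨⟨biproduct.ι Y i ≫ e.inv, e.hom ≫ biproduct.π Y i, by simp⟩⟩
      rw [E.normalizedTrace_eq (hY i) hk] at this
      rw [hk, this]
    have hsum : ∀ f : E.Γ ⊗ X ⟶ E.Γ ⊗ X, f = ∑ i, E.Γ ◁ (e.hom ≫ biproduct.π Y i) ≫
        E.Γ ◁ (biproduct.ι Y i ≫ e.inv) ≫ f := fun f => by
      conv_lhs => rw [← Category.id_comp f, ← whiskerLeft_id, id_eq_sum_of_iso_biproduct e,
        whiskerLeft_sum, Preadditive.sum_comp]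
      simp
    rw [hsum (doubleBraiding E.Γ X), hsum (E.toEnd g ▷ X)]
    refine Finset.sum_congr rfl fun i _ => ?_
    rw [doubleBraiding_naturality_right, key, whisker_exchange]
  · rintro ⟨r⟩
    refine E.normalizedTrace_eq hY ?_
    calc
      _ = E.Γ ◁ (r.i ≫ r.r) ≫ doubleBraiding E.Γ Y := by simp
      _ = E.Γ ◁ r.i ≫ E.toEnd g ▷ X ≫ E.Γ ◁ r.r := by
        rw [MonoidalCategory.whiskerLeft_comp, Category.assoc, doubleBraiding_naturality_right, h]
      _ = _ := by
        rw [whisker_exchange_assoc, ← MonoidalCategory.whiskerLeft_comp, r.retract]; simp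

lemma degree_unique {X : C} {g h : G} (hg : E.IsHomogeneousOfDegree X g)
    (hh : E.IsHomogeneousOfDegree X h) : g = h := by
  obtain ⟨Y, hY, hr⟩ := exists_simple_retract F hg.1
  exact E.toEnd_injective ((hg.2 Y hY hr).symm.trans (hh.2 Y hY hr))

lemma isHomogeneousOfDegree_of_iso {X Y : C} {g : G} (e : X ≅ Y)
    (h : E.IsHomogeneousOfDegree X g) : E.IsHomogeneousOfDegree Y g :=
  ⟨fun hY => h.1 (hY.of_iso e), fun Z hZ ⟨r⟩ => h.2 Z hZ ⟨⟨r.i ≫ e.inv, e.hom ≫ r.r, by simp⟩⟩⟩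

include hS in
lemma isHomogeneousOfDegree_tensor {X Y : C} {g h : G} (hX : E.IsHomogeneousOfDegree X g)
    (hY : E.IsHomogeneousOfDegree Y h) : E.IsHomogeneousOfDegree (X ⊗ Y) (g * h) := by
  rw [E.isHomogeneousOfDegree_iff hS] at *
  refine ⟨not_isZero_tensor F hX.1 hY.1, ?_⟩
  rw [doubleBraiding_tensor_right hX.2 hY.2, map_mul]
  rfl

include hS in
lemma isHomogeneousOfDegree_unit : E.IsHomogeneousOfDegree (𝟙_ C) 1 := by
  rw [E.isHomogeneousOfDegree_iff hS]
  refine ⟨fun h => id_unit_ne_zero F (h.eq_of_src _ _), ?_⟩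
  rw [doubleBraiding_unit_right, map_one]
  exact (id_whiskerRight _ _).symm

include hS in
lemma exists_isHomogeneousOfDegree_of_simple {X : C} (hX : Simple X) :
    ∃ g : G, E.IsHomogeneousOfDegree X g := by
  obtain ⟨g, hg⟩ := E.exists_doubleBraiding_eq_toEnd hS hX
  exact ⟨g, (E.isHomogeneousOfDegree_iff hS).2 ⟨not_isZero_of_simple X, hg⟩⟩

lemma isStrictTensorFunctor_id : IsStrictTensorFunctor (𝟭 C) where
  unit := rfl
  tensor_obj _ _ := rfl
  tensor_map _ _ := HEq.rfl
  associator _ _ _ := HEq.rfl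
  leftUnitor _ := HEq.rfl
  rightUnitor _ := HEq.rfl

/-- The `G`-grading of `C`, as a crossed `G`-category with trivial action. -/
def crossedCategory : CrossedCategory G C where
  homogeneous X := ∃ g : G, E.IsHomogeneousOfDegree X g
  homogeneous_unit := ⟨1, E.isHomogeneousOfDegree_unit hS⟩
  homogeneous_tensor := fun ⟨_, hX⟩ ⟨_, hY⟩ => ⟨_, E.isHomogeneousOfDegree_tensor hS hX hY⟩
  degree _ h := h.choose
  degree_iso hX hY e := E.degree_unique (E.isHomogeneousOfDegree_of_iso e hX.choose_spec)
    hY.choose_spec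
  degree_tensor hX hY := E.degree_unique (Exists.choose_spec (p := fun g =>
    E.IsHomogeneousOfDegree _ g) _) (E.isHomogeneousOfDegree_tensor hS hX.choose_spec
    hY.choose_spec)
  action _ := 𝟭 C
  action_strict _ := isStrictTensorFunctor_id
  action_one := rfl
  action_mul _ _ := rfl
  homogeneous_action _ _ h := h
  degree_action g _ _ := (mul_inv_cancel_comm g _).symm
  decomposition X := by
    obtain ⟨n, Y, hY, he⟩ := IsSemisimpleTensor.semisimple F X
    exact ⟨n, Y, fun i => E.exists_isHomogeneousOfDegree_of_simple hS (hY i), he⟩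

/-- A non-zero `f` is non-zero on some simple summand of `X`, which is then also a summand of `Y`;
its degree is both `g` and `h`. -/
lemma hom_eq_zero_of_degree_ne {X Y : C} {g h : G} (hX : E.IsHomogeneousOfDegree X g)
    (hY : E.IsHomogeneousOfDegree Y h) (hgh : g ≠ h) (f : X ⟶ Y) : f = 0 := by
  by_contra hf
  obtain ⟨n, Z, hZ, ⟨e⟩⟩ := IsSemisimpleTensor.semisimple F X
  have : ∃ i, (biproduct.ι Z i ≫ e.inv) ≫ f ≠ 0 := by
    by_contra! h
    apply hf
    rw [← cancel_epi e.inv]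
    ext i
    simpa using h i
  obtain ⟨i, hi⟩ := this
  have := hZ i
  obtain ⟨r, hr⟩ := exists_comp_eq_id_of_simple_source F hi
  refine hgh (E.toEnd_injective ((hX.2 (Z i) (hZ i) ?_).symm.trans (hY.2 (Z i) (hZ i) ?_)))
  · exact ⟨⟨biproduct.ι Z i ≫ e.inv, e.hom ≫ biproduct.π Z i, by simp⟩⟩
  · exact ⟨⟨_, r, hr⟩⟩

end Grading

end RepEquivalence

end GradedBTC
end

noncomputable section

namespace GradedBTC

attribute [local instance] Abelian.hasFiniteBiproducts

/-! ### Commuting actions on a common object -/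

section CommutingActions

variable {C : Type w} [Category.{v} C] [MonoidalCategory C] [BraidedCategory C]

/-- Two morphisms `Y ⊗ T ⟶ T` and `Z ⊗ T ⟶ T` commute up to the braiding of `Y` and `Z`. -/
def ActionsCommute {Y Z T : C} (σ : Y ⊗ T ⟶ T) (τ : Z ⊗ T ⟶ T) : Prop :=
  Y ◁ τ ≫ σ = (α_ Y Z T).inv ≫ (β_ Y Z).hom ▷ T ≫ (α_ Z Y T).hom ≫ Z ◁ σ ≫ τ

/-- The action of `Y` on `P ⊗ T` obtained from an action of `Y` on `T` by braiding past `P`. -/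
def liftAction {Y T : C} (P : C) (σ : Y ⊗ T ⟶ T) : Y ⊗ (P ⊗ T) ⟶ P ⊗ T :=
  (α_ Y P T).inv ≫ (β_ Y P).hom ▷ T ≫ (α_ P Y T).hom ≫ P ◁ σ

instance {Y T : C} (P : C) (σ : Y ⊗ T ⟶ T) [IsIso σ] : IsIso (liftAction P σ) := by
  unfold liftAction; infer_instance

/-- The action of `U ⊗ W` obtained from actions of `U` and `W`. -/
def compAction {U W T : C} (σ : U ⊗ T ⟶ T) (τ : W ⊗ T ⟶ T) : (U ⊗ W) ⊗ T ⟶ T :=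
  (α_ U W T).hom ≫ U ◁ τ ≫ σ

instance {U W T : C} (σ : U ⊗ T ⟶ T) (τ : W ⊗ T ⟶ T) [IsIso σ] [IsIso τ] :
    IsIso (compAction σ τ) := by
  unfold compAction; infer_instance

namespace ActionsCommute

lemma symm {Y Z T : C} {σ : Y ⊗ T ⟶ T} {τ : Z ⊗ T ⟶ T} (h : ActionsCommute σ τ)
    (hb : (β_ Z Y).hom ≫ (β_ Y Z).hom = 𝟙 _) : ActionsCommute τ σ := by
  unfold ActionsCommute at *
  rw [h, Iso.hom_inv_id_assoc, ← comp_whiskerRight_assoc, hb]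
  simp

/-- Exchanging the order in which `Y` and `Z` are braided past `P` is the Yang–Baxter equation. -/
lemma lift {Y Z T : C} (P : C) {σ : Y ⊗ T ⟶ T} {τ : Z ⊗ T ⟶ T} (h : ActionsCommute σ τ) :
    ActionsCommute (liftAction P σ) (liftAction P τ) := by
  unfold ActionsCommute at *
  have hyb : 𝟙 _ ⊗≫ Y ◁ (β_ Z P).hom ⊗≫ (β_ Y P).hom ▷ Z ⊗≫ P ◁ (β_ Y Z).hom =
      (β_ Y Z).hom ▷ P ⊗≫ Z ◁ (β_ Y P).hom ⊗≫ (β_ Z P).hom ▷ Y ⊗≫ 𝟙 _ := by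
    have := BraidedCategory.yang_baxter Y Z P
    simp only [monoidalComp] at *
    rw [← cancel_epi (α_ Y Z P).inv]
    simpa using this.symm
  calc
    _ = 𝟙 _ ⊗≫ Y ◁ (β_ Z P).hom ▷ T ⊗≫ ((Y ⊗ P) ◁ τ ≫ (β_ Y P).hom ▷ T) ⊗≫ P ◁ σ := by
      simp only [liftAction]; monoidal
    _ = 𝟙 _ ⊗≫ Y ◁ (β_ Z P).hom ▷ T ⊗≫ (β_ Y P).hom ▷ (Z ⊗ T) ⊗≫ P ◁ (Y ◁ τ ≫ σ) := by
      rw [whisker_exchange]; monoidal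
    _ = 𝟙 _ ⊗≫ (𝟙 ((Y ⊗ Z) ⊗ P) ⊗≫ Y ◁ (β_ Z P).hom ⊗≫ (β_ Y P).hom ▷ Z ⊗≫ P ◁ (β_ Y Z).hom) ▷ T
        ⊗≫ P ◁ Z ◁ σ ≫ P ◁ τ := by
      rw [h]; monoidal
    _ = 𝟙 _ ⊗≫ (β_ Y Z).hom ▷ P ▷ T ⊗≫ Z ◁ (β_ Y P).hom ▷ T ⊗≫
        ((β_ Z P).hom ▷ (Y ⊗ T) ≫ (P ⊗ Z) ◁ σ) ⊗≫ P ◁ τ := by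
      rw [hyb]; monoidal
    _ = _ := by
      rw [← whisker_exchange]; simp only [liftAction]; monoidal

/-- The two actions take place on different tensor factors; only the passage of `Y` across `τ` costs
a braiding of `Y` with `Z`. -/
lemma lift_whiskerRight {Y Z P T : C} (σ : Y ⊗ T ⟶ T) (τ : Z ⊗ P ⟶ P) :
    ActionsCommute (liftAction P σ) ((α_ Z P T).inv ≫ τ ▷ T) := by
  unfold ActionsCommute
  calc
    _ = 𝟙 _ ⊗≫ (Y ◁ τ ≫ (β_ Y P).hom) ▷ T ⊗≫ P ◁ σ := by simp only [liftAction]; monoidal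
    _ = 𝟙 _ ⊗≫ (β_ Y Z).hom ▷ P ▷ T ⊗≫ Z ◁ (β_ Y P).hom ▷ T ⊗≫ (τ ▷ (Y ⊗ T) ≫ P ◁ σ) := by
      rw [BraidedCategory.braiding_naturality_right, BraidedCategory.braiding_tensor_right_hom]
      monoidal
    _ = _ := by rw [← whisker_exchange]; simp only [liftAction]; monoidal

lemma self {Z T : C} (hb : (β_ Z Z).hom = 𝟙 _) (τ : Z ⊗ T ⟶ T) : ActionsCommute τ τ := by
  simp [ActionsCommute, hb]

lemma precomp {Y Z W T : C} {σ : Y ⊗ T ⟶ T} {τ : Z ⊗ T ⟶ T} (h : ActionsCommute σ τ)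
    (f : W ⟶ Z) : ActionsCommute σ (f ▷ T ≫ τ) := by
  unfold ActionsCommute at *
  calc
    _ = Y ◁ f ▷ T ≫ Y ◁ τ ≫ σ := by simp
    _ = 𝟙 _ ⊗≫ (Y ◁ f ≫ (β_ Y Z).hom) ▷ T ⊗≫ Z ◁ σ ≫ τ := by rw [h]; monoidal
    _ = 𝟙 _ ⊗≫ (β_ Y W).hom ▷ T ⊗≫ (f ▷ (Y ⊗ T) ≫ Z ◁ σ) ≫ τ := by
      rw [BraidedCategory.braiding_naturality_right]; monoidal
    _ = _ := by rw [← whisker_exchange]; monoidal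

lemma comp {Y U W T : C} {σ : Y ⊗ T ⟶ T} {τ : U ⊗ T ⟶ T} {ξ : W ⊗ T ⟶ T}
    (hτ : ActionsCommute σ τ) (hξ : ActionsCommute σ ξ) :
    ActionsCommute σ (compAction τ ξ) := by
  unfold ActionsCommute at *
  calc
    _ = 𝟙 _ ⊗≫ Y ◁ U ◁ ξ ≫ (Y ◁ τ ≫ σ) := by simp only [compAction]; monoidal
    _ = 𝟙 _ ⊗≫ ((Y ⊗ U) ◁ ξ ≫ (β_ Y U).hom ▷ T) ⊗≫ U ◁ σ ≫ τ := by rw [hτ]; monoidal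
    _ = 𝟙 _ ⊗≫ (β_ Y U).hom ▷ (W ⊗ T) ⊗≫ U ◁ (Y ◁ ξ ≫ σ) ≫ τ := by
      rw [whisker_exchange]; monoidal
    _ = _ := by
      rw [hξ, BraidedCategory.braiding_tensor_right_hom]; simp only [compAction]; monoidal

lemma unitor {Y T : C} (σ : Y ⊗ T ⟶ T) : ActionsCommute σ (λ_ T).hom := by
  simp [ActionsCommute]

end ActionsCommute

end CommutingActions

section Existence

variable {C : Type w} [Category.{v} C] [Abelian C] [MonoidalCategory C]
  [MonoidalPreadditive C] [BraidedCategory C]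

/-- If all `X a` commute symmetrically, have trivial self-braiding and fix a common object `P`, then
they act on a common object by pairwise commuting isomorphisms. -/
lemma exists_commuting_actions (S : ObjectProperty C) (hunit : S (𝟙_ C))
    (htensor : ∀ {X Y : C}, S X → S Y → S (X ⊗ Y)) {A : Type*} (X : A → C)
    (hsymm : ∀ a b, (β_ (X a) (X b)).hom ≫ (β_ (X b) (X a)).hom = 𝟙 _)
    (hself : ∀ a, (β_ (X a) (X a)).hom = 𝟙 _) {P : C} (hP : S P)
    (τ : ∀ a, X a ⊗ P ≅ P) (L : Finset A) :
    ∃ (T : C) (σ : ∀ a, X a ⊗ T ⟶ T), S T ∧ (∀ a b, ActionsCommute (σ a) (σ b)) ∧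
      ∀ a ∈ L, IsIso (σ a) := by
  classical
  induction L using Finset.induction_on with
  -- Nothing has to be invertible yet, so zero actions will do.
  | empty => exact ⟨𝟙_ C, fun a => 0, hunit, fun a b => by simp [ActionsCommute], by simp⟩
  | insert x L hx ih =>
    obtain ⟨T, σ, hT, hc, hi⟩ := ih
    let ν : X x ⊗ (P ⊗ T) ⟶ P ⊗ T := (α_ (X x) P T).inv ≫ (τ x).hom ▷ T
    -- The new label `x` acts on the new factor `P` by an isomorphism, replacing its old action; all
    -- other labels act on `T` past `P`. The action of `x` commutes with itself because its
    -- self-braiding is trivial.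
    refine ⟨P ⊗ T, Function.update (fun a => liftAction P (σ a)) x ν, htensor hP hT, ?_, ?_⟩
    · intro a b
      by_cases ha : a = x
      · subst ha
        by_cases hb : b = a
        · subst hb
          simpa using ActionsCommute.self (hself b) ν
        · simpa [Function.update_of_ne hb] using
            (ActionsCommute.lift_whiskerRight (σ b) (τ a).hom).symm (hsymm a b)
      · by_cases hb : b = x
        · subst hb
          simpa [Function.update_of_ne ha] using
            ActionsCommute.lift_whiskerRight (σ a) (τ b).hom
        · simpa [Function.update_of_ne ha, Function.update_of_ne hb] using (hc a b).lift P
    · intro a ha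
      by_cases hax : a = x
      · subst hax
        simp only [Function.update_self, ν]
        infer_instance
      · have := hi a ((Finset.mem_insert.1 ha).resolve_left hax)
        simp only [Function.update_of_ne hax]
        infer_instance

end Existence

end GradedBTC
end

noncomputable section

namespace GradedBTC

attribute [local instance] Abelian.hasFiniteBiproducts

/-- The residue field at a maximal ideal is a finite extension of `F`, so it embeds into `F`. -/
lemma exists_algHom_of_commute {F R : Type*} [Field F] [IsAlgClosed F] [Ring R] [Nontrivial R]
    [Algebra F R] [FiniteDimensional F R] (h : ∀ x y : R, x * y = y * x) :
    Nonempty (R →ₐ[F] F) := by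
  let : CommRing R := { ‹Ring R› with mul_comm := h }
  obtain ⟨m, hm⟩ := Ideal.exists_maximal R
  let := Ideal.Quotient.field m
  have : Module.Finite F (R ⧸ m) :=
    Module.Finite.of_surjective (Ideal.Quotient.mkₐ F m).toLinearMap
      (Ideal.Quotient.mkₐ_surjective F m)
  exact ⟨(IsAlgClosed.lift (R := F) (S := R ⧸ m) (M := F)).comp (Ideal.Quotient.mkₐ F m)⟩

/-! ### Normalizing scalars by a character of the centre of the commutant -/

section Normalization

variable {F : Type u} [Field F]
variable {C : Type w} [Category.{v} C] [Abelian C] [Linear F C] [MonoidalCategory C]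
  [MonoidalPreadditive C] [MonoidalLinear F C] [BraidedCategory C]

variable {A : Type*} {X : A → C} {T : C}

variable (F) in
/-- The endomorphisms of `T` that commute with all the given actions. -/
def actionCommutant (σ : ∀ a, X a ⊗ T ⟶ T) : Subalgebra F (End T) where
  carrier := {r | ∀ a, X a ◁ r ≫ σ a = σ a ≫ r}
  mul_mem' {r s} hr hs a := by
    change X a ◁ (s ≫ r) ≫ σ a = σ a ≫ (s ≫ r)
    have h1 : X a ◁ (show T ⟶ T from r) ≫ σ a = σ a ≫ r := hr a
    have h2 : X a ◁ (show T ⟶ T from s) ≫ σ a = σ a ≫ s := hs a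
    rw [MonoidalCategory.whiskerLeft_comp, Category.assoc, h1, reassoc_of% h2]
  add_mem' {r s} hr hs a := by
    change X a ◁ ((show T ⟶ T from r) + (show T ⟶ T from s)) ≫ σ a =
      σ a ≫ ((show T ⟶ T from r) + (show T ⟶ T from s))
    have h1 : X a ◁ (show T ⟶ T from r) ≫ σ a = σ a ≫ r := hr a
    have h2 : X a ◁ (show T ⟶ T from s) ≫ σ a = σ a ≫ s := hs a
    rw [MonoidalPreadditive.whiskerLeft_add, Preadditive.add_comp, h1, h2, Preadditive.comp_add]
  algebraMap_mem' c a := by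
    change X a ◁ (c • 𝟙 T) ≫ σ a = σ a ≫ (c • 𝟙 T)
    simp

variable (F) in
/-- The centre of the commutant of the actions. -/
def actionCenter (σ : ∀ a, X a ⊗ T ⟶ T) : Subalgebra F (End T) :=
  actionCommutant F σ ⊓ Subalgebra.centralizer F (actionCommutant F σ : Set (End T))

lemma mem_actionCenter {σ : ∀ a, X a ⊗ T ⟶ T} {r : T ⟶ T} :
    (r : End T) ∈ actionCenter F σ ↔ (∀ a, X a ◁ r ≫ σ a = σ a ≫ r) ∧
      ∀ s : T ⟶ T, (∀ a, X a ◁ s ≫ σ a = σ a ≫ s) → r ≫ s = s ≫ r :=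
  Iff.trans (Algebra.mem_inf (A := End T))
    (and_congr Iff.rfl (Subalgebra.mem_centralizer_iff F (A := End T)))

lemma actionCenter_mul_comm {σ : ∀ a, X a ⊗ T ⟶ T} (x y : actionCenter F σ) : x * y = y * x := by
  apply Subtype.ext
  exact (mem_actionCenter.1 y.2).2 x.1 (mem_actionCenter.1 x.2).1

/-- An action of `W` on `T` that is compatible with all the given actions and with their
commutant. -/
structure IsCompatibleAction (σ : ∀ a, X a ⊗ T ⟶ T) {W : C} (s : W ⊗ T ⟶ T) : Prop where
  isIso : IsIso s
  commute : ∀ a, ActionsCommute (σ a) s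
  commutant : ∀ r : T ⟶ T, (∀ a, X a ◁ r ≫ σ a = σ a ≫ r) → W ◁ r ≫ s = s ≫ r

namespace IsCompatibleAction

variable {σ : ∀ a, X a ⊗ T ⟶ T}

lemma of_mem (hi : ∀ a, IsIso (σ a)) (hc : ∀ a b, ActionsCommute (σ a) (σ b)) (a : A) :
    IsCompatibleAction σ (σ a) := ⟨hi a, fun b => hc b a, fun _ hr => hr a⟩

lemma precomp {W W' : C} {s : W ⊗ T ⟶ T} (hs : IsCompatibleAction σ s) (f : W' ⟶ W) [IsIso f] :
    IsCompatibleAction σ (f ▷ T ≫ s) := by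
  have := hs.isIso
  refine ⟨inferInstance, fun a => (hs.commute a).precomp f, fun r hr => ?_⟩
  rw [whisker_exchange_assoc, hs.commutant r hr, Category.assoc]

lemma comp {U W : C} {s : U ⊗ T ⟶ T} {t : W ⊗ T ⟶ T} (hs : IsCompatibleAction σ s)
    (ht : IsCompatibleAction σ t) : IsCompatibleAction σ (compAction s t) := by
  have := hs.isIso
  have := ht.isIso
  refine ⟨inferInstance, fun a => (hs.commute a).comp (ht.commute a), fun r hr => ?_⟩
  have h1 : U ◁ W ◁ r ≫ U ◁ t = U ◁ t ≫ U ◁ r := by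
    rw [← MonoidalCategory.whiskerLeft_comp, ht.commutant r hr,
      MonoidalCategory.whiskerLeft_comp]
  rw [compAction, associator_naturality_right_assoc, reassoc_of% h1, hs.commutant r hr]
  simp

lemma unitor : IsCompatibleAction σ (λ_ T).hom :=
  ⟨inferInstance, fun a => ActionsCommute.unitor _, fun r _ => by simp⟩

/-- The discrepancy of two compatible actions of the same object lies in the centre of the
commutant. -/
lemma inv_comp_mem {W : C} {s t : W ⊗ T ⟶ T} (hs : IsCompatibleAction σ s)
    (ht : IsCompatibleAction σ t) :
    ((haveI := hs.isIso; inv s ≫ t : T ⟶ T) : End T) ∈ actionCenter F σ := by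
  have := hs.isIso
  have hr : s ≫ (inv s ≫ t) = t := by simp
  generalize (inv s ≫ t : T ⟶ T) = r at hr
  rw [mem_actionCenter]
  constructor
  · intro a
    have h1 := hs.commute a
    have h2 := ht.commute a
    unfold ActionsCommute at h1 h2
    rw [← cancel_epi (X a ◁ s), ← MonoidalCategory.whiskerLeft_comp_assoc, hr, h2, reassoc_of% h1,
      hr]
  · intro q hq
    rw [← cancel_epi s, reassoc_of% hr, ← ht.commutant q hq, ← reassoc_of% hs.commutant q hq, hr]

end IsCompatibleAction

variable {σ : ∀ a, X a ⊗ T ⟶ T}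

/-- Two actions of `W` agree after evaluation at a character of the centre of the commutant. -/
def ActionsAgree (χ : actionCenter F σ →ₐ[F] F) {W : C} (s t : W ⊗ T ⟶ T) : Prop :=
  ∃ x y : actionCenter F σ, χ x = 1 ∧ χ y = 1 ∧ s ≫ (x.1 : T ⟶ T) = t ≫ (y.1 : T ⟶ T)

namespace ActionsAgree

variable {χ : actionCenter F σ →ₐ[F] F}

lemma symm {W : C} {s t : W ⊗ T ⟶ T} (h : ActionsAgree χ s t) : ActionsAgree χ t s := by
  obtain ⟨x, y, hx, hy, h⟩ := h
  exact ⟨y, x, hy, hx, h.symm⟩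

lemma comp_comm (x y : actionCenter F σ) :
    (x.1 : T ⟶ T) ≫ (y.1 : T ⟶ T) = (y.1 : T ⟶ T) ≫ (x.1 : T ⟶ T) :=
  (mem_actionCenter.1 x.2).2 y.1 (mem_actionCenter.1 y.2).1

/-- The correcting elements multiply, and they can be interchanged since the centre is commutative.
-/
lemma trans {W : C} {s t q : W ⊗ T ⟶ T} (h : ActionsAgree χ s t) (h' : ActionsAgree χ t q) :
    ActionsAgree χ s q := by
  obtain ⟨x, y, hx, hy, h⟩ := h
  obtain ⟨x', y', hx', hy', h'⟩ := h'
  refine ⟨x' * x, y * y', by rw [map_mul, hx, hx', mul_one], by rw [map_mul, hy, hy', mul_one], ?_⟩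
  change s ≫ ((x.1 : T ⟶ T) ≫ (x'.1 : T ⟶ T)) = q ≫ ((y'.1 : T ⟶ T) ≫ (y.1 : T ⟶ T))
  rw [reassoc_of% h, comp_comm, reassoc_of% h']

lemma precomp {W V : C} {s t : W ⊗ T ⟶ T} (h : ActionsAgree χ s t) (f : V ⊗ T ⟶ W ⊗ T) :
    ActionsAgree χ (f ≫ s) (f ≫ t) := by
  obtain ⟨x, y, hx, hy, h⟩ := h
  exact ⟨x, y, hx, hy, by rw [Category.assoc, h, Category.assoc]⟩

lemma comp_left {U W : C} {s t : U ⊗ T ⟶ T} (h : ActionsAgree χ s t) (q : W ⊗ T ⟶ T) :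
    ActionsAgree χ (compAction s q) (compAction t q) := by
  obtain ⟨x, y, hx, hy, h⟩ := h
  exact ⟨x, y, hx, hy, by simp [compAction, h]⟩

/-- The correcting elements lie in the commutant, so they pass through `σ a`. -/
lemma comp_right {W : C} (a : A) {s t : W ⊗ T ⟶ T} (h : ActionsAgree χ s t) :
    ActionsAgree χ (compAction (σ a) s) (compAction (σ a) t) := by
  obtain ⟨x, y, hx, hy, h⟩ := h
  refine ⟨x, y, hx, hy, ?_⟩
  have h1 := (mem_actionCenter.1 x.2).1 a
  have h2 := (mem_actionCenter.1 y.2).1 a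
  simp only [compAction, Category.assoc]
  rw [← h1, ← h2, ← MonoidalCategory.whiskerLeft_comp_assoc, h,
    MonoidalCategory.whiskerLeft_comp_assoc]

lemma eq_one_of_smul {W : C} {s : W ⊗ T ⟶ T} [IsIso s] {c : F} (h : ActionsAgree χ (c • s) s) :
    c = 1 := by
  obtain ⟨x, y, hx, hy, h⟩ := h
  have h1 : c • x = y := by
    apply Subtype.ext
    change c • (x.1 : T ⟶ T) = (y.1 : T ⟶ T)
    rw [← cancel_epi s, ← h, Linear.smul_comp]
    exact Linear.comp_smul ..
  rw [← hy, ← h1, map_smul, hx, smul_eq_mul, mul_one]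

end ActionsAgree

/-- The discrepancy `x` between the action through `f` and `s` is invertible in the centre, so `χ x`
is non-zero and `f` can be rescaled by it. -/
lemma exists_isIso_actionsAgree (χ : actionCenter F σ →ₐ[F] F) {W : C} {s : W ⊗ T ⟶ T}
    (hs : IsCompatibleAction σ s) {c : A} (hc : IsCompatibleAction σ (σ c)) (f : W ≅ X c) :
    ∃ g : W ⟶ X c, IsIso g ∧ ActionsAgree χ (g ▷ T ≫ σ c) s := by
  have hf := hc.precomp f.hom
  have := hf.isIso
  have := hs.isIso
  let x : actionCenter F σ := ⟨_, hf.inv_comp_mem hs⟩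
  let y : actionCenter F σ := ⟨_, hs.inv_comp_mem hf⟩
  have hxy : x * y = 1 := by
    apply Subtype.ext
    change (inv s ≫ _) ≫ (inv (f.hom ▷ T ≫ σ c) ≫ s) = 𝟙 T
    rw [Category.assoc, IsIso.hom_inv_id_assoc, IsIso.inv_hom_id]
  have hx0 : χ x ≠ 0 := fun h0 => by
    have := congrArg χ hxy
    rw [map_mul, h0, zero_mul, map_one] at this
    exact zero_ne_one this
  have hg : IsIso (χ x • f.hom) := ⟨(χ x)⁻¹ • f.inv, by simp [smul_smul, hx0], by
    simp [smul_smul, hx0]⟩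
  refine ⟨χ x • f.hom, hg, (χ x)⁻¹ • x, 1, ?_, map_one χ, ?_⟩
  · rw [map_smul, smul_eq_mul, inv_mul_cancel₀ hx0]
  · change ((χ x • f.hom) ▷ T ≫ σ c) ≫ ((χ x)⁻¹ • (inv (f.hom ▷ T ≫ σ c) ≫ s)) = s ≫ 𝟙 T
    rw [MonoidalLinear.smul_whiskerRight, Linear.smul_comp, Linear.comp_smul, Linear.smul_comp,
      smul_smul, inv_mul_cancel₀ hx0, one_smul, IsIso.hom_inv_id_assoc, Category.comp_id]

/-- The two morphisms differ by a scalar, and the character sees that scalar. -/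
lemma eq_of_actionsAgree {χ : actionCenter F σ →ₐ[F] F} {W : C} {c : A} [IsIso (σ c)]
    (hend : ∀ k : X c ⟶ X c, ∃ a : F, k = a • 𝟙 (X c)) {f g : W ⟶ X c} [IsIso g]
    (h : ActionsAgree χ (f ▷ T ≫ σ c) (g ▷ T ≫ σ c)) : f = g := by
  obtain ⟨a, ha⟩ := hend (inv g ≫ f)
  have hf : f = a • g := by
    rw [← cancel_epi (inv g), ha]; simp
  have h1 : f ▷ T ≫ σ c = a • (g ▷ T ≫ σ c) := by
    rw [hf, MonoidalLinear.smul_whiskerRight, Linear.smul_comp]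
  rw [h1] at h
  rw [hf, h.eq_one_of_smul, one_smul]

end Normalization

end GradedBTC
end

/-! ### Coherent multiplication on the simple objects -/

noncomputable section

namespace GradedBTC

attribute [local instance] Abelian.hasFiniteBiproducts

/-- Coherent multiplication isomorphisms `X a ⊗ X b ≅ X (a b)` and `𝟙 ≅ X 1` for a family of
objects of a braided category, indexed by an abelian group. -/
structure CoherentFamily {C : Type w} [Category.{v} C] [MonoidalCategory C] [BraidedCategory C]
    {A : Type*} [CommGroup A] (X : A → C) where
  mul : ∀ {a b c : A}, a * b = c → (X a ⊗ X b ⟶ X c)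
  one : 𝟙_ C ⟶ X 1
  isIso_mul : ∀ {a b c : A} (h : a * b = c), IsIso (mul h)
  isIso_one : IsIso one
  assoc : ∀ {a b c ab bc abc : A} (h₁ : a * b = ab) (h₂ : ab * c = abc) (h₃ : b * c = bc)
    (h₄ : a * bc = abc),
    mul h₁ ▷ X c ≫ mul h₂ = (α_ (X a) (X b) (X c)).hom ≫ X a ◁ mul h₃ ≫ mul h₄
  comm : ∀ {a b c : A} (h : a * b = c) (h' : b * a = c), (β_ (X a) (X b)).hom ≫ mul h' = mul h
  one_mul : ∀ {a : A} (h : 1 * a = a), one ▷ X a ≫ mul h = (λ_ (X a)).hom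

section CompAction

variable {C : Type w} [Category.{v} C] [MonoidalCategory C] [BraidedCategory C]

lemma compAction_precomp_left {U U' W T : C} (f : U' ⟶ U) (s : U ⊗ T ⟶ T) (t : W ⊗ T ⟶ T) :
    compAction (f ▷ T ≫ s) t = f ▷ W ▷ T ≫ compAction s t := by
  simp only [compAction]
  rw [associator_naturality_left_assoc, ← whisker_exchange_assoc]

lemma compAction_precomp_right {U W W' T : C} (f : W' ⟶ W) (s : U ⊗ T ⟶ T) (t : W ⊗ T ⟶ T) :
    compAction s (f ▷ T ≫ t) = (U ◁ f) ▷ T ≫ compAction s t := by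
  simp only [compAction]
  monoidal

lemma compAction_assoc {U V W T : C} (s : U ⊗ T ⟶ T) (t : V ⊗ T ⟶ T) (q : W ⊗ T ⟶ T) :
    (α_ U V W).hom ▷ T ≫ compAction s (compAction t q) = compAction (compAction s t) q := by
  simp only [compAction]
  monoidal

lemma compAction_unitor {W T : C} (t : W ⊗ T ⟶ T) :
    compAction (λ_ T).hom t = (λ_ W).hom ▷ T ≫ t := by
  simp only [compAction]
  monoidal

lemma ActionsCommute.braiding_compAction {U W T : C} {s : U ⊗ T ⟶ T} {t : W ⊗ T ⟶ T}
    (h : ActionsCommute s t) : (β_ U W).hom ▷ T ≫ compAction t s = compAction s t := by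
  unfold ActionsCommute at h
  rw [compAction, compAction, h]
  simp

end CompAction

section Existence

variable (F : Type u) [Field F]
variable {C : Type w} [Category.{v} C] [Abelian C] [Linear F C] [MonoidalCategory C]
  [MonoidalPreadditive C] [MonoidalLinear F C] [BraidedCategory C] [RightRigidCategory C]
  [IsSemisimpleTensor F C]

/-- Composition of actions on `T` is associative, unital, and commutative up to the braiding. Once
the multiplications are normalized by `χ`, both sides of each coherence equation agree with the same
composite action, so they are equal by `eq_of_actionsAgree`. -/
lemma exists_coherentFamily_of_actions [IsAlgClosed F] {A : Type*} [CommGroup A] {X : A → C}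
    (hX : ∀ a, Simple (X a)) (hone : Nonempty (𝟙_ C ≅ X 1))
    (hmul : ∀ a b, Nonempty (X a ⊗ X b ≅ X (a * b))) {T : C} (hT : ¬ IsZero T)
    (σ : ∀ a, X a ⊗ T ⟶ T) (hi : ∀ a, IsIso (σ a)) (hc : ∀ a b, ActionsCommute (σ a) (σ b)) :
    Nonempty (CoherentFamily X) := by
  have hfin : FiniteDimensional F (End T) := finiteDimensional_hom F T T
  have : Nontrivial (actionCenter F σ) := ⟨0, 1, fun h => hT
    ((IsZero.iff_id_eq_zero T).2 (congrArg Subtype.val h).symm)⟩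
  obtain ⟨χ⟩ := exists_algHom_of_commute (F := F) (actionCenter_mul_comm (F := F) (σ := σ))
  have hσ := IsCompatibleAction.of_mem hi hc
  have hend : ∀ (c : A) (k : X c ⟶ X c), ∃ a : F, k = a • 𝟙 (X c) := fun c => end_simple F
  have hm : ∀ {a b c : A} (_ : a * b = c), ∃ g : X a ⊗ X b ⟶ X c, IsIso g ∧
      ActionsAgree χ (g ▷ T ≫ σ c) (compAction (σ a) (σ b)) := fun {a b c} h =>
    exists_isIso_actionsAgree χ ((hσ a).comp (hσ b)) (hσ c) (h ▸ (hmul a b).some)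
  choose m hmi hma using @hm
  obtain ⟨e, he, hea⟩ := exists_isIso_actionsAgree χ IsCompatibleAction.unitor (hσ 1) hone.some
  refine ⟨⟨m, e, fun h => hmi h, he, ?_, ?_, ?_⟩⟩
  · intro a b c ab bc abc h₁ h₂ h₃ h₄
    have := hmi h₁; have := hmi h₂; have := hmi h₃; have := hmi h₄
    refine eq_of_actionsAgree (χ := χ) (hend abc) ?_
    have hl : ActionsAgree χ ((m h₁ ▷ X c ≫ m h₂) ▷ T ≫ σ abc)
        (compAction (compAction (σ a) (σ b)) (σ c)) := by
      rw [comp_whiskerRight, Category.assoc]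
      refine ((hma h₂).precomp _).trans ?_
      rw [← compAction_precomp_left]
      exact (hma h₁).comp_left _
    have hr : ActionsAgree χ (((α_ (X a) (X b) (X c)).hom ≫ X a ◁ m h₃ ≫ m h₄) ▷ T ≫ σ abc)
        (compAction (compAction (σ a) (σ b)) (σ c)) := by
      rw [comp_whiskerRight, comp_whiskerRight, Category.assoc, Category.assoc]
      refine (((hma h₄).precomp _).precomp _).trans ?_
      rw [← compAction_precomp_right, ← compAction_assoc]
      exact ((hma h₃).comp_right a).precomp _
    exact hl.trans hr.symm
  · intro a b c h h'
    have := hmi h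
    refine eq_of_actionsAgree (χ := χ) (hend c) ?_
    rw [comp_whiskerRight, Category.assoc]
    refine ((hma h').precomp _).trans ?_
    rw [(hc a b).braiding_compAction]
    exact (hma h).symm
  · intro a h
    refine eq_of_actionsAgree (χ := χ) (hend a) ?_
    rw [comp_whiskerRight, Category.assoc]
    refine ((hma h).precomp _).trans ?_
    rw [← compAction_precomp_left, ← compAction_unitor]
    exact hea.comp_left _

lemma exists_coherentFamily [IsAlgClosed F] {A : Type} [CommGroup A] [Finite A] {X : A → C}
    (hX : ∀ a, Simple (X a)) (hone : Nonempty (𝟙_ C ≅ X 1))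
    (hmul : ∀ a b, Nonempty (X a ⊗ X b ≅ X (a * b)))
    (hsymm : ∀ a b, (β_ (X a) (X b)).hom ≫ (β_ (X b) (X a)).hom = 𝟙 _)
    (hself : ∀ a, (β_ (X a) (X a)).hom = 𝟙 _) : Nonempty (CoherentFamily X) := by
  have := Fintype.ofFinite A
  have hP : ¬ IsZero (⨁ X) := fun h => by
    have := hX 1
    refine id_nonzero (X 1) ?_
    rw [← biproduct.ι_π_self, h.eq_of_tgt (biproduct.ι X 1) 0, zero_comp]
  -- Tensoring with `X a` permutes the summands by translation, so the sum of all `X b` is a common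
  -- fixed object.
  let τ : ∀ a, X a ⊗ ⨁ X ≅ ⨁ X := fun a => leftDistributor (X a) X ≪≫
    biproduct.whiskerEquiv (Equiv.mulLeft a) fun b => (hmul a b).some.symm
  obtain ⟨T, σ, hT, hc, hi⟩ := exists_commuting_actions (fun Y : C => ¬ IsZero Y)
    (fun h => id_unit_ne_zero F (h.eq_of_src _ _)) (not_isZero_tensor F) X hsymm hself hP τ
    Finset.univ
  exact exists_coherentFamily_of_actions F hX hone hmul hT σ (fun a => hi a (Finset.mem_univ a)) hc

end Existence

section Representatives

variable {C : Type w} [Category.{v} C] [Abelian C] [MonoidalCategory C]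
  [BraidedCategory C] [RightRigidCategory C] {S : ObjectProperty C}

lemma exists_representatives (hS : IsFiniteFullTensorSubcategory S) :
    ∃ (A : Type) (_ : Finite A) (X : A → C), (∀ a, S (X a)) ∧ (∀ a, Simple (X a)) ∧
      (∀ a b, Nonempty (X a ≅ X b) → a = b) ∧
      ∀ Y : C, S Y → Simple Y → ∃ a, Nonempty (Y ≅ X a) := by
  obtain ⟨n, Z, hZ⟩ := hS.finite
  let s : Setoid {i : Fin n // S (Z i) ∧ Simple (Z i)} :=
    ⟨fun i j => Nonempty (Z i ≅ Z j), fun _ => ⟨Iso.refl _⟩, fun ⟨e⟩ => ⟨e.symm⟩,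
      fun ⟨e⟩ ⟨e'⟩ => ⟨e ≪≫ e'⟩⟩
  refine ⟨Quotient s, inferInstance, fun q => Z q.out, fun q => q.out.2.1, fun q => q.out.2.2,
    fun a b h => ?_, fun Y hY hY' => ?_⟩
  · rw [← Quotient.out_eq a, ← Quotient.out_eq b]
    exact Quotient.sound h
  · obtain ⟨i, ⟨e⟩⟩ := hZ Y hY hY'
    let j : {i : Fin n // S (Z i) ∧ Simple (Z i)} :=
      ⟨i, hS.iso e hY, Simple.of_iso e.symm⟩
    obtain ⟨e'⟩ : Nonempty (Z (Quotient.mk s j).out ≅ Z j) := Quotient.mk_out (s := s) j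
    exact ⟨Quotient.mk s j, ⟨e ≪≫ e'.symm⟩⟩

/-- The isomorphism classes of simple objects of `S` form a finite abelian group if the simple
objects are invertible. -/
lemma exists_group_of_simples (hS : IsFiniteFullTensorSubcategory S)
    (hunit : Simple (𝟙_ C))
    (htensor : ∀ X Y : C, S X → Simple X → S Y → Simple Y → Simple (X ⊗ Y))
    (hdual : ∀ X : C, S X → Simple X → Simple (Xᘁ) ∧ IsIso (η_ X Xᘁ)) :
    ∃ (A : Type) (_ : CommGroup A) (_ : Finite A) (X : A → C), (∀ a, S (X a)) ∧
      (∀ a, Simple (X a)) ∧ (∀ a b, Nonempty (X a ≅ X b) → a = b) ∧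
      (∀ Y : C, S Y → Simple Y → ∃ a, Nonempty (Y ≅ X a)) ∧
      Nonempty (𝟙_ C ≅ X 1) ∧ ∀ a b, Nonempty (X a ⊗ X b ≅ X (a * b)) := by
  obtain ⟨A, hA, X, hXS, hX, huniq, hex⟩ := exists_representatives hS
  choose m hm using fun a b => hex (X a ⊗ X b) (hS.tensor (hXS a) (hXS b))
    (htensor _ _ (hXS a) (hX a) (hXS b) (hX b))
  obtain ⟨o, ho⟩ := hex (𝟙_ C) hS.unit hunit
  choose d hd using fun a => hex (X a)ᘁ (hS.dual (hXS a)) (hdual _ (hXS a) (hX a)).1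
  have hcomm : ∀ a b, m a b = m b a := fun a b =>
    huniq _ _ ⟨(hm a b).some.symm ≪≫ β_ _ _ ≪≫ (hm b a).some⟩
  let G : CommGroup A :=
    { mul := m
      one := o
      inv := d
      mul_assoc := fun a b c => huniq _ _ ⟨(hm (m a b) c).some.symm ≪≫
        whiskerRightIso (hm a b).some.symm (X c) ≪≫ α_ _ _ _ ≪≫
        whiskerLeftIso (X a) (hm b c).some ≪≫ (hm a (m b c)).some⟩
      one_mul := fun a => huniq _ _ ⟨(hm o a).some.symm ≪≫
        whiskerRightIso ho.some.symm (X a) ≪≫ λ_ _⟩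
      mul_one := fun a => huniq _ _ ⟨(hm a o).some.symm ≪≫
        whiskerLeftIso (X a) ho.some.symm ≪≫ ρ_ _⟩
      inv_mul_cancel := fun a => huniq _ _ ⟨(hm (d a) a).some.symm ≪≫
        whiskerRightIso (hd a).some.symm (X a) ≪≫ (β_ _ _) ≪≫
        (haveI := (hdual _ (hXS a) (hX a)).2; (asIso (η_ (X a) (X a)ᘁ)).symm) ≪≫ ho.some⟩
      mul_comm := hcomm }
  exact ⟨A, G, hA, X, hXS, hX, huniq, hex, ho, hm⟩

end Representatives

end GradedBTC
end

noncomputable section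

namespace GradedBTC

/-! ### Weight vectors for the dual group -/

section Weights

variable {F : Type u} [Field F] {A : Type} [CommGroup A]

/-- `v` is a vector of weight `a` for the dual group of `A`. -/
def IsWeight (V : FDRep F (A →* Fˣ)) (a : A) (v : V) : Prop :=
  ∀ g : A →* Fˣ, V.ρ g v = (g a : F) • v

lemma IsWeight.map {V W : FDRep F (A →* Fˣ)} {a : A} {v : V} (h : IsWeight V a v) (f : V ⟶ W) :
    IsWeight W a (repLin f v) := fun g => by rw [← repLin_ρ, h g, map_smul]

lemma IsWeight.tmul {V W : FDRep F (A →* Fˣ)} {a b c : A} (hc : a * b = c) {v : V} {w : W}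
    (hv : IsWeight V a v) (hw : IsWeight W b w) : IsWeight (V ⊗ W) c (repTmul V W v w) := fun g => by
  rw [repTmul_ρ, hv, hw, ← hc, map_mul, Units.val_mul, map_smul, map_smul, LinearMap.smul_apply,
    smul_smul, mul_comm]

lemma isWeight_repOne : IsWeight (𝟙_ (FDRep F (A →* Fˣ))) 1 repOne := fun g => by
  rw [repOne_ρ, map_one, Units.val_one, one_smul]

lemma isWeight_sum_smul {V : FDRep F (A →* Fˣ)} {a : A} {J : Type*} (s : Finset J) (c : J → F)
    (b : J → V) (h : ∀ j ∈ s, c j = 0 ∨ IsWeight V a (b j)) :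
    IsWeight V a (∑ j ∈ s, c j • b j) := fun g => by
  rw [map_sum, Finset.smul_sum]
  refine Finset.sum_congr rfl fun j hj => ?_
  rcases h j hj with h | h
  · simp [h]
  · rw [map_smul, h g, smul_comm]

variable [Finite A] [IsAlgClosed F] [CharZero F]

lemma exists_dual_apply_ne {a b : A} (h : a ≠ b) : ∃ g : A →* Fˣ, (g a : F) ≠ g b := by
  by_contra! hg
  refine h ((CommGroup.forall_apply_eq_apply_iff A (M := F)).1 fun g => ?_)
  exact Units.ext (hg g)

/-- Every vector is a sum of weight vectors. -/
lemma exists_eq_sum_weights (V : FDRep F (A →* Fˣ)) (v : V) [Fintype A] :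
    ∃ p : A → V, (∀ a, IsWeight V a (p a)) ∧ v = ∑ a, p a := by
  classical
  have := Fintype.ofFinite (A →* Fˣ)
  have hcard : (Fintype.card (A →* Fˣ) : F) = Fintype.card A := by
    rw [← Nat.card_eq_fintype_card, ← Nat.card_eq_fintype_card,
      CommGroup.card_monoidHom_of_hasEnoughRootsOfUnity A F]
  have hA : (Fintype.card A : F) ≠ 0 := Nat.cast_ne_zero.2 Fintype.card_ne_zero
  -- These are the averaging projections onto the weight spaces; that they sum to the identity is
  -- the orthogonality relation `h1`.
  refine ⟨fun a => (Fintype.card A : F)⁻¹ • ∑ g : A →* Fˣ, ((g a)⁻¹ : Fˣ).val • V.ρ g v,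
    fun a k => ?_, ?_⟩
  · rw [map_smul, smul_comm]
    congr 1
    rw [map_sum, Finset.smul_sum]
    refine Fintype.sum_equiv (Equiv.mulLeft k) _ _ fun g => ?_
    rw [map_smul, ← Module.End.mul_apply, ← map_mul, smul_smul, Equiv.coe_mulLeft]
    congr 1
    rw [MonoidHom.mul_apply, mul_inv, Units.val_mul, ← mul_assoc, Units.mul_inv, one_mul]
  · rw [← Finset.smul_sum, Finset.sum_comm]
    have h1 : ∀ g : A →* Fˣ, ∑ a, ((g a)⁻¹ : Fˣ).val • V.ρ g v =
        if g = 1 then (Fintype.card A : F) • v else 0 := fun g => by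
      rw [← Finset.sum_smul]
      have h2 : ∑ a, ((g a)⁻¹ : Fˣ).val = ∑ a, (Units.coeHom F).comp g⁻¹ a := rfl
      rw [h2, sum_hom_units]
      have h3 : (Units.coeHom F).comp g⁻¹ = 1 ↔ g = 1 := by
        rw [← inv_eq_one (a := g)]
        constructor
        · intro h
          ext a
          exact DFunLike.congr_fun h a
        · rintro h
          rw [h]; rfl
      by_cases hg : g = 1
      · rw [if_pos (h3.2 hg), if_pos hg, hg, map_one, Module.End.one_apply]
      · rw [if_neg (fun h => hg (h3.1 h)), if_neg hg, Nat.cast_zero, zero_smul]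
    rw [Finset.sum_congr rfl fun g _ => h1 g, Finset.sum_ite_eq' Finset.univ (1 : A →* Fˣ)]
    simp [smul_smul, hA]

/-- A representation has a basis of weight vectors. -/
lemma exists_weight_basis (V : FDRep F (A →* Fˣ)) :
    ∃ (n : ℕ) (b : Module.Basis (Fin n) F V) (w : Fin n → A), ∀ i, IsWeight V (w i) (b i) := by
  have := Fintype.ofFinite A
  let s : Set V := {v | ∃ a, IsWeight V a v}
  have hs : ⊤ ≤ Submodule.span F s := fun v _ => by
    obtain ⟨p, hp, rfl⟩ := exists_eq_sum_weights V v
    exact Submodule.sum_mem _ fun a _ => Submodule.subset_span ⟨a, hp a⟩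
  let b := Module.Basis.ofSpan hs
  have hfin : Finite _ := Module.Finite.finite_basis b
  have := Fintype.ofFinite ((linearIndepOn_empty F id).extend (Set.empty_subset s))
  have hb : ∀ i, ∃ a, IsWeight V a (b i) := fun i =>
    Module.Basis.ofSpan_subset hs (Set.mem_range_self i)
  choose w hw using hb
  exact ⟨_, b.reindex (Fintype.equivFin _), w ∘ (Fintype.equivFin _).symm, fun i => by
    simpa using hw _⟩

/-- A character `g` separating `w j` from `a` multiplies the `j`-th coordinate by `g (w j)` and,
since `v` has weight `a`, also by `g a`. -/
lemma repr_eq_zero_of_isWeight {V : FDRep F (A →* Fˣ)} {J : Type*} [Finite J]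
    (b : Module.Basis J F V) {w : J → A} (hb : ∀ j, IsWeight V (w j) (b j)) {a : A} {v : V}
    (hv : IsWeight V a v) {j : J} (hj : w j ≠ a) : b.repr v j = 0 := by
  have := Fintype.ofFinite J
  obtain ⟨g, hg⟩ := exists_dual_apply_ne (F := F) hj
  have h1 : b.repr (V.ρ g v) j = (g (w j) : F) * b.repr v j := by
    conv_lhs => rw [← b.sum_repr v]
    rw [map_sum, map_sum, Finsupp.finsetSum_apply, Finset.sum_eq_single j]
    · rw [map_smul, hb j g, map_smul, map_smul, b.repr_self]; simp [mul_comm]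
    · intro k _ hk
      rw [map_smul, hb k g, map_smul, map_smul, b.repr_self]; simp [hk]
    · simp
  rw [hv g, map_smul, Finsupp.smul_apply, smul_eq_mul] at h1
  have h2 : ((g (w j) : F) - g a) * b.repr v j = 0 := by rw [sub_mul, h1, sub_self]
  exact (mul_eq_zero.1 h2).resolve_left (sub_ne_zero.2 hg)

/-- A linear condition holds for all vectors of weight `a` if it holds for those in a basis of
weight vectors. -/
lemma weight_induction {V : FDRep F (A →* Fˣ)} {J : Type*} [Finite J]
    (b : Module.Basis J F V) {w : J → A} (hb : ∀ j, IsWeight V (w j) (b j)) {a : A}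
    {M : Type*} [AddCommGroup M] [Module F M] {f g : V →ₗ[F] M}
    (h : ∀ j, w j = a → f (b j) = g (b j)) {v : V} (hv : IsWeight V a v) : f v = g v := by
  have := Fintype.ofFinite J
  rw [← b.sum_repr v, map_sum, map_sum]
  refine Finset.sum_congr rfl fun j _ => ?_
  by_cases hj : w j = a
  · rw [map_smul, map_smul, h j hj]
  · rw [repr_eq_zero_of_isWeight b hb hv hj, zero_smul, map_zero, map_zero]

end Weights

end GradedBTC
end

noncomputable section

namespace GradedBTC

attribute [local instance] Abelian.hasFiniteBiproducts

section WeightBasis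

variable {F : Type u} [Field F] [IsAlgClosed F] [CharZero F] {A : Type} [CommGroup A] [Finite A]

/-- The size of a chosen basis of weight vectors. -/
def wtRank (V : FDRep F (A →* Fˣ)) : ℕ := (exists_weight_basis V).choose

/-- A chosen basis of weight vectors. -/
def wtBasis (V : FDRep F (A →* Fˣ)) : Module.Basis (Fin (wtRank V)) F V :=
  (exists_weight_basis V).choose_spec.choose

/-- The weights of the chosen basis vectors. -/
def wtOf (V : FDRep F (A →* Fˣ)) : Fin (wtRank V) → A :=
  (exists_weight_basis V).choose_spec.choose_spec.choose

lemma isWeight_wtBasis (V : FDRep F (A →* Fˣ)) (i : Fin (wtRank V)) :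
    IsWeight V (wtOf V i) (wtBasis V i) :=
  (exists_weight_basis V).choose_spec.choose_spec.choose_spec i

end WeightBasis

/-! ### The realization functor -/

section Realization

variable {F : Type u} [Field F] [IsAlgClosed F] [CharZero F] {A : Type} [CommGroup A] [Finite A]
variable {C : Type w} [Category.{v} C] [Abelian C] [Linear F C]
variable (X : A → C)

/-- The object of `C` realizing a representation: the sum of the `X a` over a basis of weight
vectors. -/
abbrev realObj (V : FDRep F (A →* Fˣ)) : C := ⨁ fun i => X (wtOf V i)

/-- The morphism `X a ⟶ realObj X V` attached to a vector of weight `a`. -/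
def inc (V : FDRep F (A →* Fˣ)) (a : A) : V →ₗ[F] (X a ⟶ realObj X V) :=
  -- Basis vectors of other weights go to zero, which makes the map linear on all of `V`; its
  -- compatibilities with descended maps are stated for vectors of weight `a`.
  (wtBasis V).constr F fun i =>
    open Classical in if h : a = wtOf V i then
      eqToHom (congrArg X h) ≫ biproduct.ι (fun i => X (wtOf V i)) i else 0

lemma inc_wtBasis (V : FDRep F (A →* Fˣ)) (i : Fin (wtRank V)) :
    inc X V (wtOf V i) (wtBasis V i) = biproduct.ι (fun i => X (wtOf V i)) i := by
  rw [inc, Module.Basis.constr_basis, dif_pos rfl, eqToHom_refl, Category.id_comp]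

variable {X}

/-- The morphism out of `realObj X V` determined by its values on weight vectors. -/
def realDesc {V : FDRep F (A →* Fˣ)} {Z : C} (φ : ∀ a, V →ₗ[F] (X a ⟶ Z)) : realObj X V ⟶ Z :=
  biproduct.desc fun i => φ (wtOf V i) (wtBasis V i)

lemma inc_realDesc {V : FDRep F (A →* Fˣ)} {Z : C} (φ : ∀ a, V →ₗ[F] (X a ⟶ Z)) {a : A} {v : V}
    (hv : IsWeight V a v) : inc X V a v ≫ realDesc φ = φ a v := by
  refine weight_induction (wtBasis V) (isWeight_wtBasis V)
    (f := Linear.rightComp F _ (realDesc φ) ∘ₗ inc X V a) (fun j hj => ?_) hv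
  subst hj
  rw [LinearMap.comp_apply, inc_wtBasis]
  exact biproduct.ι_desc _ _

/-- Additive functors turn the weight vectors into a jointly epimorphic family. -/
lemma real_functor_hom_ext {D : Type*} [Category* D] [Preadditive D] (H : C ⥤ D) [H.Additive]
    {V : FDRep F (A →* Fˣ)} {Z : D} {f g : H.obj (realObj X V) ⟶ Z}
    (h : ∀ a v, IsWeight V a v → H.map (inc X V a v) ≫ f = H.map (inc X V a v) ≫ g) : f = g := by
  have hid : H.map (𝟙 (realObj X V)) = ∑ i, H.map (biproduct.π (fun i => X (wtOf V i)) i) ≫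
      H.map (inc X V (wtOf V i) (wtBasis V i)) := by
    simp only [inc_wtBasis, ← H.map_comp, ← H.map_sum]
    rw [biproduct.total]
  rw [CategoryTheory.Functor.map_id] at hid
  rw [← Category.id_comp f, ← Category.id_comp g, hid, Preadditive.sum_comp, Preadditive.sum_comp]
  refine Finset.sum_congr rfl fun i _ => ?_
  rw [Category.assoc, Category.assoc, h _ _ (isWeight_wtBasis V i)]

lemma real_hom_ext {V : FDRep F (A →* Fˣ)} {Z : C} {f g : realObj X V ⟶ Z}
    (h : ∀ a v, IsWeight V a v → inc X V a v ≫ f = inc X V a v ≫ g) : f = g :=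
  real_functor_hom_ext (𝟭 C) h

lemma inc_comp_π (V : FDRep F (A →* Fˣ)) (v : V) (i : Fin (wtRank V)) :
    inc X V (wtOf V i) v ≫ biproduct.π (fun i => X (wtOf V i)) i =
      (wtBasis V).repr v i • 𝟙 _ := by
  have : Linear.rightComp F _ (biproduct.π (fun i => X (wtOf V i)) i) ∘ₗ inc X V (wtOf V i) =
      (LinearMap.toSpanSingleton F _ (𝟙 (X (wtOf V i)))) ∘ₗ ((wtBasis V).coord i) := by
    refine (wtBasis V).ext fun j => ?_
    rw [LinearMap.comp_apply, LinearMap.comp_apply, LinearMap.toSpanSingleton_apply,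
      Module.Basis.coord_apply, Module.Basis.repr_self]
    change inc X V (wtOf V i) (wtBasis V j) ≫ _ = _
    by_cases hij : j = i
    · subst hij
      rw [inc_wtBasis]
      simp
    · rw [inc, Module.Basis.constr_basis, Finsupp.single_eq_of_ne (Ne.symm hij), zero_smul]
      split_ifs
      · rw [Category.assoc, biproduct.ι_π_ne _ hij, comp_zero]
      · rw [zero_comp]
  exact LinearMap.congr_fun this v

lemma eq_zero_of_inc_eq_zero (hX : ∀ a, Simple (X a)) {V : FDRep F (A →* Fˣ)} {a : A} {v : V}
    (hv : IsWeight V a v) (h : inc X V a v = 0) : v = 0 := by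
  rw [← (wtBasis V).sum_repr v]
  refine Finset.sum_eq_zero fun i _ => ?_
  by_cases hi : wtOf V i = a
  · subst hi
    have h1 := inc_comp_π (X := X) V v i
    rw [h, zero_comp] at h1
    have := hX (wtOf V i)
    rw [(smul_eq_zero.1 h1.symm).resolve_right (id_nonzero _), zero_smul]
  · rw [repr_eq_zero_of_isWeight _ (isWeight_wtBasis V) hv hi, zero_smul]

/-- By Schur's lemma the morphisms from `X a` see only the summands of weight `a`. Together with
`eq_zero_of_inc_eq_zero` this identifies them with the weight space, whence fullness and
faithfulness. -/
lemma exists_eq_inc (hend : ∀ a (k : X a ⟶ X a), ∃ c : F, k = c • 𝟙 (X a))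
    (hne : ∀ a b, a ≠ b → ∀ k : X a ⟶ X b, k = 0) {V : FDRep F (A →* Fˣ)} {a : A}
    (k : X a ⟶ realObj X V) : ∃ v, IsWeight V a v ∧ k = inc X V a v := by
  have h1 : ∀ i, ∃ c : F, (c = 0 ∨ wtOf V i = a) ∧
      k ≫ biproduct.π (fun i => X (wtOf V i)) i ≫ biproduct.ι (fun i => X (wtOf V i)) i =
        c • inc X V a (wtBasis V i) := fun i => by
    by_cases hi : wtOf V i = a
    · subst hi
      obtain ⟨c, hc⟩ := hend _ (k ≫ biproduct.π (fun i => X (wtOf V i)) i)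
      refine ⟨c, Or.inr rfl, ?_⟩
      rw [reassoc_of% hc, inc_wtBasis]
      simp
    · refine ⟨0, Or.inl rfl, ?_⟩
      rw [← Category.assoc, hne _ _ (Ne.symm hi) (k ≫ _), zero_comp, zero_smul]
  choose c hc hk using h1
  refine ⟨∑ i, c i • wtBasis V i, isWeight_sum_smul _ _ _ fun i _ =>
    (hc i).imp_right fun (h : wtOf V i = a) => h ▸ isWeight_wtBasis V i, ?_⟩
  rw [map_sum]
  simp only [map_smul, ← hk]
  rw [← Preadditive.comp_sum, biproduct.total]
  exact (Category.comp_id k).symm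

/-- The realization of a representation computed from any basis of weight vectors. -/
def realIso {V : FDRep F (A →* Fˣ)} {n : ℕ} (b : Module.Basis (Fin n) F V) (w : Fin n → A)
    (hb : ∀ j, IsWeight V (w j) (b j)) : realObj X V ≅ ⨁ fun j => X (w j) where
  hom := realDesc fun a => b.constr F fun j =>
    open Classical in if h : a = w j then
      eqToHom (congrArg X h) ≫ biproduct.ι (fun j => X (w j)) j else 0
  inv := biproduct.desc fun j => inc X V (w j) (b j)
  hom_inv_id := by
    refine real_hom_ext fun a v hv => ?_
    rw [← Category.assoc, inc_realDesc _ hv, Category.comp_id]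
    refine weight_induction b hb (f := Linear.rightComp F _ _ ∘ₗ b.constr F _) (fun j hj => ?_) hv
    subst hj
    rw [LinearMap.comp_apply, Module.Basis.constr_basis, dif_pos rfl]
    simp
  inv_hom_id := by
    refine biproduct.hom_ext' _ _ fun j => ?_
    rw [biproduct.ι_desc_assoc, inc_realDesc _ (hb j), Module.Basis.constr_basis, dif_pos rfl]
    simp

variable (X) in
/-- The realization of a morphism of representations. -/
def realMap {V W : FDRep F (A →* Fˣ)} (f : V ⟶ W) : realObj X V ⟶ realObj X W :=
  realDesc fun a => inc X _ a ∘ₗ repLin f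

lemma inc_realMap {V W : FDRep F (A →* Fˣ)} (f : V ⟶ W) {a : A} {v : V} (hv : IsWeight V a v) :
    inc X V a v ≫ realMap X f = inc X W a (repLin f v) :=
  inc_realDesc _ hv

variable (F X) in
/-- The realization functor. -/
def realFunctor : FDRep F (A →* Fˣ) ⥤ C where
  obj := realObj X
  map := realMap X
  map_id V := real_hom_ext fun a v hv => by
    rw [inc_realMap _ hv, Category.comp_id, repLin_id]
  map_comp f g := real_hom_ext fun a v hv => by
    rw [inc_realMap _ hv, reassoc_of% (inc_realMap (X := X) f hv),
      inc_realMap _ (hv.map f), repLin_comp]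

instance : (realFunctor F X).Additive where
  map_add {V W f g} := by
    change realMap X (f + g) = realMap X f + realMap X g
    refine real_hom_ext fun a v hv => ?_
    rw [Preadditive.comp_add, inc_realMap _ hv, inc_realMap _ hv, inc_realMap _ hv, repLin_add,
      LinearMap.add_apply, map_add]

instance : (realFunctor F X).Linear F where
  map_smul {V W} f c := by
    change realMap X (c • f) = c • realMap X f
    refine real_hom_ext fun a v hv => ?_
    rw [Linear.comp_smul, inc_realMap _ hv, inc_realMap _ hv, repLin_smul, LinearMap.smul_apply,
      map_smul]

lemma realFunctor_faithful (hX : ∀ a, Simple (X a)) : (realFunctor F X).Faithful where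
  map_injective {V W f g} h := by
    change realMap X f = realMap X g at h
    have : repLin f = repLin g := (wtBasis V).ext fun i => by
      have hw := isWeight_wtBasis V i
      rw [← sub_eq_zero]
      refine eq_zero_of_inc_eq_zero hX (a := wtOf V i) (fun k => ?_) ?_
      · rw [map_sub, hw.map f k, hw.map g k, smul_sub]
      · rw [map_sub, ← inc_realMap f hw, ← inc_realMap g hw, h, sub_self]
    exact repLin_injective fun v => LinearMap.congr_fun this v

lemma realFunctor_full (hend : ∀ a (k : X a ⟶ X a), ∃ c : F, k = c • 𝟙 (X a))
    (hne : ∀ a b, a ≠ b → ∀ k : X a ⟶ X b, k = 0) : (realFunctor F X).Full where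
  map_surjective {V W} k := by
    change realObj X V ⟶ realObj X W at k
    choose u hu hk using fun i =>
      exists_eq_inc hend hne (inc X V (wtOf V i) (wtBasis V i) ≫ k)
    let T : V →ₗ[F] W := (wtBasis V).constr F u
    have hT : ∀ i, T (wtBasis V i) = u i := fun i => Module.Basis.constr_basis _ _ _ i
    refine ⟨repHom T fun g v => ?_, ?_⟩
    · have : T ∘ₗ V.ρ g = W.ρ g ∘ₗ T := (wtBasis V).ext fun i => by
        rw [LinearMap.comp_apply, LinearMap.comp_apply, isWeight_wtBasis V i g, map_smul, hT,
          hu i g]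
      exact LinearMap.congr_fun this v
    · change realMap X _ = k
      refine biproduct.hom_ext' _ _ fun i => ?_
      rw [← inc_wtBasis X V i, inc_realMap _ (isWeight_wtBasis V i), repLin_repHom, hT]
      exact (hk i).symm

end Realization

end GradedBTC
end

noncomputable section

namespace GradedBTC

attribute [local instance] Abelian.hasFiniteBiproducts

/-! ### The braided monoidal structure of the realization functor -/

section TensorLin

variable {F : Type u} [Field F] {C : Type w} [Category.{v} C] [Preadditive C] [Linear F C]
  [MonoidalCategory C] [MonoidalPreadditive C] [MonoidalLinear F C]

/-- The tensor product of two linear families of morphisms. -/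
def tensorLin {M N : Type*} [AddCommGroup M] [Module F M] [AddCommGroup N] [Module F N]
    {P P' Q Q' : C} (f : M →ₗ[F] (P ⟶ P')) (g : N →ₗ[F] (Q ⟶ Q')) :
    M →ₗ[F] N →ₗ[F] (P ⊗ Q ⟶ P' ⊗ Q') :=
  LinearMap.mk₂ F (fun m n => f m ⊗ₘ g n)
    (fun m m' n => by rw [map_add, MonoidalPreadditive.add_tensor])
    (fun c m n => by
      rw [map_smul, MonoidalCategory.tensorHom_def, MonoidalLinear.smul_whiskerRight,
        Linear.smul_comp, MonoidalCategory.tensorHom_def])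
    (fun m n n' => by rw [map_add, MonoidalPreadditive.tensor_add])
    (fun c m n => by
      rw [map_smul, MonoidalCategory.tensorHom_def, MonoidalLinear.whiskerLeft_smul,
        Linear.comp_smul, MonoidalCategory.tensorHom_def])

end TensorLin

section Realization

variable {F : Type u} [Field F] [IsAlgClosed F] [CharZero F] {A : Type} [CommGroup A] [Finite A]

/-- The basis of a tensor product given by the chosen bases of weight vectors. -/
def tmulBasis (V W : FDRep F (A →* Fˣ)) :
    Module.Basis (Fin (wtRank V) × Fin (wtRank W)) F (V ⊗ W : FDRep F (A →* Fˣ)) :=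
  (wtBasis V).tensorProduct (wtBasis W)

lemma tmulBasis_apply (V W : FDRep F (A →* Fˣ)) (p : Fin (wtRank V) × Fin (wtRank W)) :
    tmulBasis V W p = repTmul V W (wtBasis V p.1) (wtBasis W p.2) :=
  Module.Basis.tensorProduct_apply' _ _ _

lemma isWeight_tmulBasis (V W : FDRep F (A →* Fˣ)) (p : Fin (wtRank V) × Fin (wtRank W)) :
    IsWeight (V ⊗ W) (wtOf V p.1 * wtOf W p.2) (tmulBasis V W p) := by
  rw [tmulBasis_apply]
  exact (isWeight_wtBasis V p.1).tmul rfl (isWeight_wtBasis W p.2)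

variable (F A) in
/-- The basis of the unit representation. -/
def oneBasis : Module.Basis Unit F (𝟙_ (FDRep F (A →* Fˣ)) : FDRep F (A →* Fˣ)) :=
  Module.Basis.singleton Unit F

lemma oneBasis_apply (j : Unit) : oneBasis F A j = repOne :=
  Module.Basis.singleton_apply Unit F j

variable {C : Type w} [Category.{v} C] [Abelian C] [Linear F C]
  [MonoidalCategory C] [MonoidalPreadditive C]
variable {X : A → C}

lemma real_tensor_hom_ext {V W : FDRep F (A →* Fˣ)} {Z : C} {f g : realObj X V ⊗ realObj X W ⟶ Z}
    (h : ∀ i j, (inc X V (wtOf V i) (wtBasis V i) ⊗ₘ inc X W (wtOf W j) (wtBasis W j)) ≫ f =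
      (inc X V (wtOf V i) (wtBasis V i) ⊗ₘ inc X W (wtOf W j) (wtBasis W j)) ≫ g) : f = g := by
  have hid : ∀ V : FDRep F (A →* Fˣ), 𝟙 (realObj X V) =
      ∑ i, biproduct.π (fun i => X (wtOf V i)) i ≫ inc X V (wtOf V i) (wtBasis V i) := fun V => by
    simp only [inc_wtBasis, biproduct.total]
  rw [← Category.id_comp f, ← Category.id_comp g, ← id_tensorHom_id, hid V, hid W, sum_tensor,
    Preadditive.sum_comp, Preadditive.sum_comp]
  refine Finset.sum_congr rfl fun i _ => ?_
  rw [tensor_sum, Preadditive.sum_comp, Preadditive.sum_comp]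
  refine Finset.sum_congr rfl fun j _ => ?_
  rw [← tensorHom_comp_tensorHom, Category.assoc, Category.assoc, h]

lemma real_tensor_tensor_hom_ext {U V W : FDRep F (A →* Fˣ)} {Z : C}
    {f g : (realObj X U ⊗ realObj X V) ⊗ realObj X W ⟶ Z}
    (h : ∀ a u, IsWeight U a u → ∀ b v, IsWeight V b v → ∀ c w, IsWeight W c w →
      ((inc X U a u ⊗ₘ inc X V b v) ⊗ₘ inc X W c w) ≫ f =
        ((inc X U a u ⊗ₘ inc X V b v) ⊗ₘ inc X W c w) ≫ g) : f = g := by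
  refine real_functor_hom_ext (tensorLeft (realObj X U ⊗ realObj X V)) fun c w hw => ?_
  refine real_functor_hom_ext (tensorLeft (realObj X U) ⋙ tensorRight (X c)) fun b v hv => ?_
  refine real_functor_hom_ext (tensorRight (X b) ⋙ tensorRight (X c)) fun a u hu => ?_
  have := h a u hu b v hv c w hw
  simpa [MonoidalCategory.tensorHom_def] using this

variable [MonoidalLinear F C] [BraidedCategory C] (K : CoherentFamily X)

/-- The multiplication of the realization functor. -/
def realMul (V W : FDRep F (A →* Fˣ)) : realObj X V ⊗ realObj X W ⟶ realObj X (V ⊗ W) :=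
  ∑ i, ∑ j, (biproduct.π (fun i => X (wtOf V i)) i ⊗ₘ biproduct.π (fun i => X (wtOf W i)) j) ≫
    K.mul rfl ≫ inc X (V ⊗ W) (wtOf V i * wtOf W j) (repTmul V W (wtBasis V i) (wtBasis W j))

lemma inc_wtBasis_realMul (V W : FDRep F (A →* Fˣ)) (i j) :
    (inc X V (wtOf V i) (wtBasis V i) ⊗ₘ inc X W (wtOf W j) (wtBasis W j)) ≫ realMul K V W =
      K.mul rfl ≫ inc X (V ⊗ W) _ (repTmul V W (wtBasis V i) (wtBasis W j)) := by
  rw [realMul, Preadditive.comp_sum, Finset.sum_eq_single i, Preadditive.comp_sum,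
    Finset.sum_eq_single j]
  · rw [inc_wtBasis, inc_wtBasis, tensorHom_comp_tensorHom_assoc, biproduct.ι_π_self,
      biproduct.ι_π_self, id_tensorHom_id, Category.id_comp]
  · intro l _ hl
    rw [inc_wtBasis X W, tensorHom_comp_tensorHom_assoc, biproduct.ι_π_ne _ hl.symm,
      MonoidalPreadditive.tensor_zero, zero_comp]
  · simp
  · intro l _ hl
    rw [Preadditive.comp_sum]
    refine Finset.sum_eq_zero fun m _ => ?_
    rw [inc_wtBasis X V, tensorHom_comp_tensorHom_assoc, biproduct.ι_π_ne _ hl.symm,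
      MonoidalPreadditive.zero_tensor, zero_comp]
  · simp

/-- Bilinearity extends the formula from basis vectors to all weight vectors, which frees it from
the chosen bases. Each axiom for the functor then becomes an axiom for `K`. -/
lemma inc_realMul {V W : FDRep F (A →* Fˣ)} {a b c : A} (h : a * b = c) {v : V} {w : W}
    (hv : IsWeight V a v) (hw : IsWeight W b w) :
    (inc X V a v ⊗ₘ inc X W b w) ≫ realMul K V W = K.mul h ≫ inc X (V ⊗ W) c (repTmul V W v w) := by
  refine weight_induction (wtBasis V) (isWeight_wtBasis V)
    (f := Linear.rightComp F _ (realMul K V W) ∘ₗ (tensorLin (inc X V a) (inc X W b)).flip w)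
    (g := Linear.leftComp F _ (K.mul h) ∘ₗ inc X (V ⊗ W) c ∘ₗ (repTmul V W).flip w)
    (fun i hi => ?_) hv
  refine weight_induction (wtBasis W) (isWeight_wtBasis W)
    (f := Linear.rightComp F _ (realMul K V W) ∘ₗ
      tensorLin (inc X V a) (inc X W b) (wtBasis V i))
    (g := Linear.leftComp F _ (K.mul h) ∘ₗ inc X (V ⊗ W) c ∘ₗ repTmul V W (wtBasis V i))
    (fun j hj => ?_) hw
  subst hi hj h
  exact inc_wtBasis_realMul K V W i j

/-- The inverse of the multiplication of the realization functor. -/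
def realComul (V W : FDRep F (A →* Fˣ)) : realObj X (V ⊗ W) ⟶ realObj X V ⊗ realObj X W :=
  realDesc fun c => (tmulBasis V W).constr F fun p =>
    open Classical in if h : wtOf V p.1 * wtOf W p.2 = c then
      haveI := K.isIso_mul h
      inv (K.mul h) ≫ (inc X V _ (wtBasis V p.1) ⊗ₘ inc X W _ (wtBasis W p.2)) else 0

/-- The multiplication of the realization functor as an isomorphism. -/
def realMulIso (V W : FDRep F (A →* Fˣ)) : realObj X V ⊗ realObj X W ≅ realObj X (V ⊗ W) where
  hom := realMul K V W
  inv := realComul K V W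
  hom_inv_id := by
    refine real_tensor_hom_ext fun i j => ?_
    have h1 := isWeight_tmulBasis V W (i, j)
    rw [← Category.assoc, inc_wtBasis_realMul, Category.assoc, ← tmulBasis_apply V W (i, j),
      realComul, inc_realDesc _ h1, Module.Basis.constr_basis, dif_pos rfl]
    simp
  inv_hom_id := by
    refine real_hom_ext fun c v hv => ?_
    rw [realComul, ← Category.assoc, inc_realDesc _ hv, Category.comp_id]
    refine weight_induction (tmulBasis V W) (isWeight_tmulBasis V W)
      (f := Linear.rightComp F _ _ ∘ₗ (tmulBasis V W).constr F _) (fun p hp => ?_) hv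
    subst hp
    rw [LinearMap.comp_apply, Module.Basis.constr_basis, dif_pos rfl, tmulBasis_apply]
    have := K.isIso_mul (a := wtOf V p.1) (b := wtOf W p.2) rfl
    simp [inc_wtBasis_realMul]

/-- The unit constraint of the realization functor. -/
def realUnitIso : 𝟙_ C ≅ realObj X (𝟙_ (FDRep F (A →* Fˣ))) :=
  haveI := K.isIso_one
  asIso K.one ≪≫
  { hom := inc X _ 1 repOne
    inv := realDesc fun a => (oneBasis F A).constr F fun _ =>
      open Classical in if h : a = 1 then eqToHom (congrArg X h) else 0
    hom_inv_id := by
      rw [inc_realDesc _ isWeight_repOne, ← oneBasis_apply (), Module.Basis.constr_basis,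
        dif_pos rfl, eqToHom_refl]
    inv_hom_id := by
      refine real_hom_ext fun a v hv => ?_
      rw [← Category.assoc, inc_realDesc _ hv, Category.comp_id]
      refine weight_induction (oneBasis F A) (w := fun _ => 1)
        (fun j => by rw [oneBasis_apply]; exact isWeight_repOne)
        (f := Linear.rightComp F _ _ ∘ₗ (oneBasis F A).constr F _) (fun j hj => ?_) hv
      subst hj
      rw [LinearMap.comp_apply, Module.Basis.constr_basis, dif_pos rfl, oneBasis_apply]
      simp }

lemma realUnitIso_hom : (realUnitIso (F := F) K).hom = K.one ≫ inc X _ 1 repOne := rfl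

lemma CoherentFamily.mul_one {X : A → C} (K : CoherentFamily X) {a : A} (h : a * 1 = a) :
    X a ◁ K.one ≫ K.mul h = (ρ_ (X a)).hom := by
  rw [← K.comm h (_root_.one_mul a), BraidedCategory.braiding_naturality_right_assoc, K.one_mul,
    braiding_leftUnitor]

lemma real_tensor_hom_ext' {V W : FDRep F (A →* Fˣ)} {Z : C} {f g : realObj X V ⊗ realObj X W ⟶ Z}
    (h : ∀ a v, IsWeight V a v → ∀ b w, IsWeight W b w →
      (inc X V a v ⊗ₘ inc X W b w) ≫ f = (inc X V a v ⊗ₘ inc X W b w) ≫ g) : f = g :=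
  real_tensor_hom_ext fun i j => h _ _ (isWeight_wtBasis V i) _ _ (isWeight_wtBasis W j)

/-- The monoidal structure of the realization functor. -/
def realCoreMonoidal : (realFunctor F X).CoreMonoidal where
  εIso := realUnitIso K
  μIso := realMulIso K
  μIso_hom_natural_left {V W} f U := by
    change realMap X f ▷ realObj X U ≫ realMul K W U = realMul K V U ≫ realMap X (f ▷ U)
    refine real_tensor_hom_ext' fun a v hv b u hu => ?_
    rw [← tensorHom_id, tensorHom_comp_tensorHom_assoc, inc_realMap _ hv, Category.comp_id,
      inc_realMul K rfl (hv.map f) hu, reassoc_of% (inc_realMul K rfl hv hu),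
      inc_realMap _ (hv.tmul rfl hu),
      repLin_whiskerRight]
  μIso_hom_natural_right {V W} U f := by
    change realObj X U ◁ realMap X f ≫ realMul K U W = realMul K U V ≫ realMap X (U ◁ f)
    refine real_tensor_hom_ext' fun a u hu b v hv => ?_
    rw [← id_tensorHom, tensorHom_comp_tensorHom_assoc, inc_realMap _ hv, Category.comp_id,
      inc_realMul K rfl hu (hv.map f), reassoc_of% (inc_realMul K rfl hu hv),
      inc_realMap _ (hu.tmul rfl hv),
      repLin_whiskerLeft]
  associativity U V W := by
    change realMul K U V ▷ realObj X W ≫ realMul K (U ⊗ V) W ≫ realMap X (α_ U V W).hom =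
      (α_ (realObj X U) (realObj X V) (realObj X W)).hom ≫ realObj X U ◁ realMul K V W ≫
        realMul K U (V ⊗ W)
    refine real_tensor_tensor_hom_ext fun a u hu b v hv c w hw => ?_
    -- Both sides are evaluated on weight vectors; the second is read at the index `a * b * c`
    -- through `mul_assoc`, so that `K.assoc` compares them.
    rw [← tensorHom_id, tensorHom_comp_tensorHom_assoc, Category.comp_id,
      inc_realMul K rfl hu hv, ← Category.id_comp (inc X W c w), ← tensorHom_comp_tensorHom_assoc,
      reassoc_of% (inc_realMul K rfl (hu.tmul rfl hv) hw),
      inc_realMap _ ((hu.tmul rfl hv).tmul rfl hw),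
      Category.id_comp, repLin_associator, MonoidalCategory.associator_naturality_assoc,
      ← id_tensorHom (realObj X U), tensorHom_comp_tensorHom_assoc, Category.comp_id,
      inc_realMul K rfl hv hw, ← Category.id_comp (inc X U a u), ← tensorHom_comp_tensorHom_assoc,
      inc_realMul K (mul_assoc a b c).symm hu (hv.tmul rfl hw), tensorHom_id,
      id_tensorHom, reassoc_of% (K.assoc rfl rfl rfl (mul_assoc a b c).symm)]
  left_unitality V := by
    change (λ_ (realObj X V)).hom = (realUnitIso K).hom ▷ realObj X V ≫ realMul K _ V ≫
      realMap X (λ_ V).hom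
    refine real_functor_hom_ext (tensorLeft (𝟙_ C)) fun a v hv => ?_
    change 𝟙_ C ◁ inc X V a v ≫ _ = 𝟙_ C ◁ inc X V a v ≫ _
    rw [leftUnitor_naturality, whisker_exchange_assoc, realUnitIso_hom, comp_whiskerRight,
      Category.assoc, ← tensorHom_def_assoc,
      reassoc_of% (inc_realMul K (one_mul a) isWeight_repOne hv),
      inc_realMap _ (isWeight_repOne.tmul (one_mul a) hv), repLin_leftUnitor,
      reassoc_of% (K.one_mul (one_mul a))]
  right_unitality V := by
    change (ρ_ (realObj X V)).hom = realObj X V ◁ (realUnitIso K).hom ≫ realMul K V _ ≫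
      realMap X (ρ_ V).hom
    refine real_functor_hom_ext (tensorRight (𝟙_ C)) fun a v hv => ?_
    change inc X V a v ▷ 𝟙_ C ≫ _ = inc X V a v ▷ 𝟙_ C ≫ _
    rw [rightUnitor_naturality, ← whisker_exchange_assoc, realUnitIso_hom,
      MonoidalCategory.whiskerLeft_comp,
      Category.assoc, ← tensorHom_def'_assoc,
      reassoc_of% (inc_realMul K (mul_one a) hv isWeight_repOne),
      inc_realMap _ (hv.tmul (mul_one a) isWeight_repOne), repLin_rightUnitor,
      reassoc_of% (K.mul_one (mul_one a))]

/-- The realization functor is braided. -/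
abbrev realBraided : (realFunctor F X).Braided where
  toMonoidal := (realCoreMonoidal K).toMonoidal
  braided V W := by
    change realMul K V W ≫ realMap X (β_ V W).hom =
      (β_ (realObj X V) (realObj X W)).hom ≫ realMul K W V
    refine real_tensor_hom_ext' fun a v hv b w hw => ?_
    rw [reassoc_of% (inc_realMul K rfl hv hw), inc_realMap _ (hv.tmul rfl hw), repLin_braiding,
      BraidedCategory.braiding_naturality_assoc, inc_realMul K (mul_comm b a) hw hv,
      ← Category.assoc, K.comm rfl]

end Realization

end GradedBTC
end

noncomputable section

namespace GradedBTC

attribute [local instance] Abelian.hasFiniteBiproducts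

/-! ### Essential image and the equivalence -/

section Diagonal

variable {F : Type u} [Field F] {A : Type} [CommGroup A]

variable (F) in
/-- The diagonal representation of the dual group of `A` with given weights. -/
def diagRep {n : ℕ} (w : Fin n → A) : FDRep F (A →* Fˣ) :=
  FDRep.of (V := Fin n → F)
    { toFun g := LinearMap.mulLeft F fun i => (g (w i) : F)
      map_one' := LinearMap.ext fun _ => one_mul _
      map_mul' _ _ := LinearMap.ext fun _ => mul_assoc _ _ _ }

variable (F) in
/-- The standard basis of a diagonal representation. -/
def diagBasis {n : ℕ} (w : Fin n → A) : Module.Basis (Fin n) F (diagRep F w) :=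
  Pi.basisFun F (Fin n)

lemma isWeight_diagBasis {n : ℕ} (w : Fin n → A) (i : Fin n) :
    IsWeight (diagRep F w) (w i) (diagBasis F w i) := fun g => by
  change (fun j => (g (w j) : F)) * Pi.basisFun F (Fin n) i = (g (w i) : F) • Pi.basisFun F (Fin n) i
  funext j
  by_cases h : j = i
  · subst h
    simp
  · simp [h]

end Diagonal

variable {F : Type u} [Field F] [IsAlgClosed F] [CharZero F]
variable {C : Type w} [Category.{v} C] [Abelian C] [Linear F C]
  [MonoidalCategory C] [MonoidalPreadditive C] [MonoidalLinear F C]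
  [BraidedCategory C] [RightRigidCategory C] [RibbonCategory C] [IsSemisimpleTensor F C]
  {S : ObjectProperty C}

/-- An object of `S` is a sum of objects `X (a i)`, and the diagonal representation with weights `a
i` realizes it. -/
lemma realFunctor_essImage (hS : IsFiniteFullTensorSubcategory S) {A : Type} [CommGroup A]
    [Finite A] {X : A → C} (hXS : ∀ a, S (X a))
    (hex : ∀ Y : C, S Y → Simple Y → ∃ a, Nonempty (Y ≅ X a)) :
    (realFunctor F X).essImage = S := by
  ext Y
  constructor
  · rintro ⟨V, ⟨e⟩⟩
    exact hS.iso e (hS.sum _ fun i => hXS _)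
  · intro hY
    obtain ⟨n, Z, hZ, ⟨e⟩⟩ := IsSemisimpleTensor.semisimple F Y
    choose a ha using fun i => hex (Z i)
      (hS.summand (X := Y) ⟨biproduct.ι Z i ≫ e.inv, e.hom ≫ biproduct.π Z i, by simp⟩ hY) (hZ i)
    exact ⟨diagRep F a, ⟨realIso (diagBasis F a) a (isWeight_diagBasis a) ≪≫
      biproduct.mapIso (fun i => (ha i).some.symm) ≪≫ e.symm⟩⟩

/-- A symmetric even subcategory whose simple objects have dimension one is the category of
representations of a finite abelian group. -/
theorem exists_repEquivalence (hS : IsFiniteFullTensorSubcategory S) (hsym : IsSymmetric S)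
    (heven : IsEven S) (hdim : ∀ X : C, S X → Simple X → dim F X = 1) :
    ∃ (G : Type u) (_ : CommGroup G) (_ : Finite G), Nonempty (RepEquivalence F G S) := by
  have hinv : ∀ X : C, S X → Simple X → IsIso (η_ X Xᘁ) := fun X hX _ =>
    isIso_coevaluation F hS hsym heven hdim hX
  obtain ⟨A, _, _, X, hXS, hX, huniq, hex, hone, hmul⟩ := exists_group_of_simples hS
    (simple_unit F)
    (fun X Y hX hX' _ hY' =>
      haveI := hinv X hX hX'
      simple_tensor_of_isIso_coevaluation F (not_isZero_of_simple X) hY')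
    (fun X hX hX' => ⟨simple_rightDual F X, hinv X hX hX'⟩)
  obtain ⟨K⟩ := exists_coherentFamily F hX hone hmul (fun a b => hsym _ _ (hXS a) (hXS b))
    (fun a =>
      haveI := hX a
      haveI := hinv _ (hXS a) (hX a)
      braiding_self_eq_id F (hdim _ (hXS a) (hX a)) (heven _ (hXS a)))
  have hess := realFunctor_essImage (F := F) hS hXS hex
  -- The group is the dual of the group of simple classes, whose elements thereby become weights.
  -- The twist condition holds because the image lies in the even subcategory `S`.
  exact ⟨A →* Fˣ, inferInstance, inferInstance,
    ⟨{ functor := realFunctor F X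
       braided := realBraided K
       full := realFunctor_full (fun a k => haveI := hX a; end_simple F k)
        (fun a b hab k =>
          haveI := hX a
          haveI := hX b
          hom_eq_zero_of_not_iso (fun h => hab (huniq a b h)) k)
       faithful := realFunctor_faithful hX
       additive := inferInstance
       linear := inferInstance
       essImage_eq := hess
       twist_eq := fun V => heven _ (hS.sum _ fun i => hXS _) }⟩⟩

end GradedBTC
end

/-! ### The main theorem -/

open GradedBTC in
theorem mainTheorem12
    (F : Type u) [Field F] [IsAlgClosed F] [CharZero F]
    (C : Type w) [Category.{v} C] [Abelian C] [Linear F C]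
    [MonoidalCategory C] [MonoidalPreadditive C] [MonoidalLinear F C]
    [BraidedCategory C] [RightRigidCategory C] [RibbonCategory C] [IsSemisimpleTensor F C]
    (S : ObjectProperty C) (hS : IsFiniteFullTensorSubcategory S) :
    ((IsSymmetric S ∧ IsEven S ∧ ∀ X : C, S X → Simple X → dim F X = 1) ↔
      ∃ (G : Type u) (_ : CommGroup G) (_ : Finite G), Nonempty (RepEquivalence F G S)) ∧
    ∀ (G : Type u) [CommGroup G] [Finite G] (E : RepEquivalence F G S),
      (Function.Injective E.toEnd ∧ ∀ f : E.Γ ⟶ E.Γ, (∃ g : G, E.toEnd g = f) ↔ IsMonHom f) ∧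
      (∀ X : C, Simple X → ∃! g : G, E.normalizedTrace X = E.toEnd g) ∧
      (∃ D : CrossedCategory G C,
        (∀ X : C, D.homogeneous X ↔ ∃ g : G, E.IsHomogeneousOfDegree X g) ∧
        (∀ (X : C) (hX : D.homogeneous X), E.IsHomogeneousOfDegree X (D.degree X hX)) ∧
        (∀ g : G, D.action g = 𝟭 C)) ∧
      (∀ (X Y : C) (g h : G), E.IsHomogeneousOfDegree X g → E.IsHomogeneousOfDegree Y h →
        g ≠ h → ∀ f : X ⟶ Y, f = 0) := by
  refine ⟨⟨fun ⟨hsym, heven, hdim⟩ => exists_repEquivalence hS hsym heven hdim, ?_⟩, ?_⟩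
  · rintro ⟨G, _, _, ⟨E⟩⟩
    exact ⟨E.isSymmetric, E.isEven, fun X hX hX' => E.dim_eq_one hX hX'⟩
  · intro G _ _ E
    refine ⟨⟨E.toEnd_injective, E.exists_toEnd_eq_iff⟩, fun X hX => ?_,
      ⟨E.crossedCategory hS, fun _ => Iff.rfl, fun X hX => hX.choose_spec, fun _ => rfl⟩,
      fun X Y g h hX hY hgh f => E.hom_eq_zero_of_degree_ne hX hY hgh f⟩
    obtain ⟨g, hg⟩ := E.exists_doubleBraiding_eq_toEnd hS hX
    exact ⟨g, E.normalizedTrace_eq hX hg, fun h hh =>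
      E.toEnd_injective (hh.symm.trans (E.normalizedTrace_eq hX hg))⟩
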